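/- **Lemma (DMD with real data).** Let $D,m\in\mathbb N$ and let $\sigma_t$ be a measurable noise schedule. Let the time $t$ be distributed according to a probability measure $\tau$ on $[0,T]$ (uniform or weighted) with $\sigma_t>0$ for $\tau$-almost every $t$. For a probability measure $p_0$ on $\mathbb R^D$ let $p_t$ be the law of $x_t=x_0+\sigma_t\epsilon$, where $x_0\sim p_0$ and $\epsilon\sim\mathcal N(0,I)$ are independent; let $p_t(\cdot|x_0)=\mathcal N(x_0,\sigma_t^2I)$ and $s_t(x|x_0)=\nabla_x\log p_t(x|x_0)=-(x-x_0)/\sigma_t^2$. For measurable, $\tau$-a.e. positive weights $w$ put $$\mathcal L^{w}_{\mathrm{DSM}}(s,p_0)=\mathbb E_{t\sim\tau}\,\mathbb E_{x_0\sim p_0,\;x_t\sim p_t(\cdot|x_0)}\big[w_t\,\|s_t(x_t)-s_t(x_t|x_0)\|^2\big].$$ Let $p_0^*$ be any probability measure on $\mathbb R^D$ (the real data). Let $p^{\mathcal Z}$ be a probability measure on a latent space $\mathcal Z$, let $G_\theta:\mathcal Z\to\mathbb R^D$ ($\theta\in\mathbb R^m$) be measurable generators, and let $p_0^\theta$ be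 the law of $G_\theta(z)$, $z\sim p^{\mathcal Z}$. Fix $\theta_0\in\mathbb R^m$ and assume that $\mathbb E_z\|G_{\theta_0}(z)\|^2<\infty$, that for almost every $z$ the map $\theta\mapsto G_\theta(z)$ is differentiable at $\theta_0$, and that for some $r>0$ and some $K\in L^2(p^{\mathcal Z})$ one has, for almost every $z$, $\|G_\theta(z)-G_{\theta_0}(z)\|\le K(z)\|\theta-\theta_0\|$ whenever $\|\theta-\theta_0\|<r$. Let $\alpha\in(0,1]$ and let $w,v$ be two weights as above ($w\equiv1$ and $v\equiv1$ are allowed). Let the teacher score $s^*$ be a minimizer of $s\mapsto\mathcal L^{w}_{\mathrm{DSM}}(s,p_0^*)$, and let the modified student score $s^{\theta_0,\alpha}$ be a minimizer of the mixed loss $$s\mapsto \alpha\,\mathcal L^{v}_{\mathrm{DSM}}(s,p_0^{\theta_0})+(1-\alpha)\,\mathcal L^{v}_{\mathrm{DSM}}(s,p_0^*),$$ both over all measurable $s:(t,x)\mapsto s_t(x)\in\mathbb R^D$ and with finite minimal value. Write $\mathrm{KL}_t(\theta)=D_{KL}\big(\alpha p_t^\theta+(1-\alpha)p_t^*\,\big\|\,p_t^*\big)$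 and, with $x_t=G_{\theta_0}(z)+\sigma_t\epsilon$, $$g_t(z,\epsilon)=\Big(\tfrac{\partial G_\theta(z)}{\partial\theta}\Big|_{\theta=\theta_0}\Big)^{\!\top}\alpha\big(s^{\theta_0,\alpha}_t(x_t)-s^*_t(x_t)\big),\qquad z\sim p^{\mathcal Z},\ \epsilon\sim\mathcal N(0,I)\text{ independent}.$$ Then: 1. For all $\theta$ in a neighbourhood of $\theta_0$, $\mathrm{KL}_t(\theta)<\infty$ for $\tau$-a.e. $t$. 2. For $\tau$-a.e. $t$, $g_t$ is integrable, $\mathrm{KL}_t$ is differentiable at $\theta_0$, and $\nabla_\theta \mathrm{KL}_t(\theta_0)=\mathbb E_{z,\epsilon}[g_t(z,\epsilon)]$. 3. If $g_t(z,\epsilon)$ is integrable over $(t,z,\epsilon)$, then $t\mapsto\nabla_\theta\mathrm{KL}_t(\theta_0)$ is $\tau$-integrable and $$\mathbb E_{t\sim\tau}\big[\nabla_\theta \mathrm{KL}_t(\theta_0)\big]=\mathbb E_{t,z,\epsilon}\Big[g_t(z,\epsilon)\Big].$$ 4. If $\mathbb E_{t\sim\tau}[\sigma_t^{-2}]<\infty$,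 then $g_t(z,\epsilon)$ is integrable over $(t,z,\epsilon)$, $t\mapsto \mathrm{KL}_t(\theta)$ is $\tau$-integrable for all $\theta$ near $\theta_0$, and $\theta\mapsto\mathbb E_{t\sim\tau}[\mathrm{KL}_t(\theta)]$ is differentiable at $\theta_0$ with $$\nabla_\theta\,\mathbb E_{t\sim\tau}[\mathrm{KL}_t(\theta)]\big|_{\theta=\theta_0}=\mathbb E_{t,z,\epsilon}\big[g_t(z,\epsilon)\big].$$ In particular $g_t(z,\epsilon)$ is an unbiased estimate of the gradient of the averaged divergence between mixed and real data. -/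

import Mathlib

open MeasureTheory ProbabilityTheory InformationTheory Filter Topology
open scoped ENNReal

noncomputable section

namespace DMD

/-- The data space `ℝ^D` with its Euclidean norm. -/
abbrev Space (D : ℕ) : Type := EuclideanSpace ℝ (Fin D)

variable {D : ℕ}

/-- The forward transition law `p_t(· | x₀) = 𝓝(x₀, σ² I)` with noise level `σ = σ_t`:
the law of `x₀ + σ ε` for a standard Gaussian `ε`. -/
def condLaw (σ : ℝ) (x₀ : Space D) : Measure (Space D) :=
  (stdGaussian (Space D)).map (fun ε => x₀ + σ • ε)

/-- The noised law `p_t`: the law of `x₀ + σ ε`, with `x₀ ∼ p₀` and an independent standard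
Gaussian `ε`. -/
def noisedLaw (σ : ℝ) (p₀ : Measure (Space D)) : Measure (Space D) :=
  (p₀.prod (stdGaussian (Space D))).map (fun y => y.1 + σ • y.2)

/-- The conditional score `s_t(x | x₀) = ∇ₓ log p_t(x | x₀) = -(x - x₀) / σ_t²`. -/
def condScore (σ : ℝ) (x₀ x : Space D) : Space D :=
  -((σ ^ 2)⁻¹ • (x - x₀))

/-- The denoising score matching loss
`E_{t ∼ τ, x₀ ∼ p₀, x_t ∼ p_t(·|x₀)} [w_t ‖s_t(x_t) - s_t(x_t|x₀)‖²]`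
with time distribution `τ`, weights `w` and noise schedule `σ`. -/
def dsmLoss (τ : Measure ℝ) (w σ : ℝ → ℝ) (p₀ : Measure (Space D))
    (s : ℝ → Space D → Space D) : ℝ≥0∞ :=
  ∫⁻ t, ∫⁻ x₀, ∫⁻ x, ENNReal.ofReal (w t * ‖s t x - condScore (σ t) x₀ x‖ ^ 2)
    ∂(condLaw (σ t) x₀) ∂p₀ ∂τ

/-- The modified loss: weight `α` on generated data `pGen`, weight `1 - α` on real data
`pReal`. -/
def mixedDsmLoss (α : ℝ) (τ : Measure ℝ) (w σ : ℝ → ℝ) (pGen pReal : Measure (Space D))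
    (s : ℝ → Space D → Space D) : ℝ≥0∞ :=
  ENNReal.ofReal α * dsmLoss τ w σ pGen s + ENNReal.ofReal (1 - α) * dsmLoss τ w σ pReal s

/-- `s` minimizes the loss `L` over all jointly measurable time-dependent vector fields, with
finite minimal value. -/
def IsArgmin (L : (ℝ → Space D → Space D) → ℝ≥0∞) (s : ℝ → Space D → Space D) : Prop :=
  Measurable (Function.uncurry s) ∧ L s ≠ ∞ ∧
    ∀ s' : ℝ → Space D → Space D, Measurable (Function.uncurry s') → L s ≤ L s'

/-- The law `p_0^θ` of `G z` for `z ∼ pZ`. -/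
def genLaw {Z : Type*} [MeasurableSpace Z] (pZ : Measure Z) (G : Z → Space D) :
    Measure (Space D) :=
  pZ.map G

/-- `D_KL(α p_t^θ + (1 - α) p_t^* ‖ p_t^*)` at noise level `σ = σ_t`. -/
def mixedKL (α σ : ℝ) (pGen pReal : Measure (Space D)) : ℝ≥0∞ :=
  klDiv (ENNReal.ofReal α • noisedLaw σ pGen + ENNReal.ofReal (1 - α) • noisedLaw σ pReal)
    (noisedLaw σ pReal)

/-- The random vector `α (s_t^{θ,α}(x_t) - s_t^*(x_t)) ∂G_θ(z)/∂θ` at `x_t = G_θ(z) + σ_t ε`: the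
transposed Jacobian of `θ ↦ G_θ(z)` applied to `α (s_t^{θ,α}(x_t) - s_t^*(x_t))`. -/
def gradSample {m : ℕ} {Z : Type*} (α : ℝ) (σ : ℝ → ℝ)
    (G : EuclideanSpace ℝ (Fin m) → Z → Space D) (sStud sTeach : ℝ → Space D → Space D)
    (θ : EuclideanSpace ℝ (Fin m)) (t : ℝ) (z : Z) (ε : Space D) : EuclideanSpace ℝ (Fin m) :=
  ContinuousLinearMap.adjoint (fderiv ℝ (fun θ' => G θ' z) θ)
    (α • (sStud t (G θ z + σ t • ε) - sTeach t (G θ z + σ t • ε)))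

end DMD

end

/-!
The divergence is expanded around the current generator. Write `u_θ` for the density of the noised
mixture at `θ`, `q` for that of the noised real data, and `ℓ = log (u_{θ₀} / q)`. Then

  `KL(u_θ ‖ q) = KL(u_{θ₀} ‖ q) + ∫ (u_θ - u_{θ₀}) ℓ + KL(u_θ ‖ u_{θ₀})`.

* The error `KL(u_θ ‖ u_{θ₀})` is second order. By joint convexity of the relative entropy it is at
  most the expected relative entropy between the Gaussians centred at `G_θ(z)` and `G_{θ₀}(z)`,
  that is `E ‖G_θ - G_{θ₀}‖² / (2 σ²) ≤ E[K²] ‖θ - θ₀‖² / (2 σ²)` (`relEnt_mix_le`,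
  `ofReal_relEnt_evid_le`, `lintegral_relEnt_kern`, `abs_mixedKL_sub_sub_le`).
* In the linear term the real data cancel, and it equals
  `α E[ℓ(G_θ(z) + σ ε) - ℓ(G_{θ₀}(z) + σ ε)]`. Here `ℓ` does not depend on `θ`, so one
  differentiates under the expectation, and `∇ℓ` is the difference of the scores of the mixture
  and of the real data.

Domination rests on the linear growth of the score of an arbitrary prior smoothed by a Gaussian
(`norm_score_le`): the posterior second moment of `x - y` is at most `-2 σ² log Z(x)`, where `Z` is
the evidence, because the posterior has nonnegative relative entropy with respect to the prior; and
`-log Z(x)` grows quadratically because the prior gives mass at least `1/2` to some ball. The same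
lower bound on `Z`, with convexity of the divergence, makes the divergence finite and of order
`1 + σ⁻²` (`exists_mixedKL_le`), with no moment assumption on the real data.

All bounds are explicit in `σ`, so the argument is carried out once, averaged over the time
(`hasGradientAt_integral_mixedKL`); the formula at a single time is the case of a Dirac time
distribution. Finally, the loss is affine in the data distribution, so the student minimizes the
loss of the mixture, and by Pythagoras at each noisy point a minimizer is almost everywhere the
exact score (`ae_eq_score_of_isArgmin`).
-/

noncomputable section

namespace DMD

variable {D : ℕ}

/-! ### Gaussian densities -/

/-- The unnormalised Gaussian kernel `exp (-‖x‖² / (2 σ²))`. -/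
def kern (σ : ℝ) (x : Space D) : ℝ := Real.exp (-((2 * σ ^ 2)⁻¹ * ‖x‖ ^ 2))

/-- The normalising constant `(2 π σ²)^(-D/2)` of the Gaussian kernel. -/
def kernConst (D : ℕ) (σ : ℝ) : ℝ := ((Real.pi / (2 * σ ^ 2)⁻¹) ^ (D / 2 : ℝ))⁻¹

/-- The evidence `∫ exp (-‖x - y‖² / (2 σ²)) p(dy)`: the density of the noised law of `p`, up to
the normalising constant of the kernel. -/
def evid (σ : ℝ) (p : Measure (Space D)) (x : Space D) : ℝ := ∫ y, kern σ (x - y) ∂p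

/-- Lebesgue measure on the data space. The type ascription fixes the Borel structure that `Space D`
carries elsewhere, which agrees with the one of the `MeasureSpace` instance only after
unfolding. -/
abbrev vol (D : ℕ) : Measure (Space D) := volume

lemma kern_pos (σ : ℝ) (x : Space D) : 0 < kern σ x := Real.exp_pos _

lemma kern_le_one (σ : ℝ) (x : Space D) : kern σ x ≤ 1 := by
  apply Real.exp_le_one_iff.2
  have : 0 ≤ (2 * σ ^ 2)⁻¹ * ‖x‖ ^ 2 := by positivity
  linarith

lemma measurable_kern : Measurable fun q : ℝ × Space D => kern q.1 q.2 := by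
  unfold kern; fun_prop

lemma kernConst_pos {σ : ℝ} (hσ : 0 < σ) : 0 < kernConst D σ := by
  unfold kernConst; positivity

@[fun_prop]
lemma measurable_kernConst : Measurable (kernConst D) := by
  unfold kernConst; fun_prop

@[fun_prop]
lemma measurable_kern_comp {Ω : Type*} [MeasurableSpace Ω] {f : Ω → ℝ} {g : Ω → Space D}
    (hf : Measurable f) (hg : Measurable g) : Measurable fun ω => kern (f ω) (g ω) :=
  measurable_kern.comp (hf.prodMk hg)

lemma integral_kern {σ : ℝ} (hσ : 0 < σ) :
    ∫ x : Space D, kern σ x = (Real.pi / (2 * σ ^ 2)⁻¹) ^ (D / 2 : ℝ) := by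
  have := GaussianFourier.integral_rexp_neg_mul_sq_norm (V := Space D) (b := (2 * σ ^ 2)⁻¹)
    (by positivity)
  simpa [kern, neg_mul] using this

lemma integrable_kern {σ : ℝ} (hσ : 0 < σ) : Integrable (fun x : Space D => kern σ x) := by
  by_contra h
  have h1 := integral_kern (D := D) hσ
  rw [integral_undef h] at h1
  have h2 : 0 < (Real.pi / (2 * σ ^ 2)⁻¹) ^ (D / 2 : ℝ) := by positivity
  linarith

lemma lintegral_kern_sub {σ : ℝ} (hσ : 0 < σ) (y : Space D) :
    ∫⁻ x : Space D, ENNReal.ofReal (kernConst D σ * kern σ (x - y)) ∂(vol D) = 1 := by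
  have h := (integrable_kern (D := D) hσ).comp_sub_right y
  rw [← ofReal_integral_eq_lintegral_ofReal (h.const_mul _)
      (ae_of_all _ fun x => mul_nonneg (kernConst_pos hσ).le (kern_pos _ _).le),
    integral_const_mul, integral_sub_right_eq_self (fun x => kern σ x) y, integral_kern hσ,
    kernConst, inv_mul_cancel₀ (by positivity), ENNReal.ofReal_one]

instance (σ : ℝ) (x₀ : Space D) : IsProbabilityMeasure (condLaw σ x₀) :=
  Measure.isProbabilityMeasure_map (by fun_prop)

instance (σ : ℝ) (p : Measure (Space D)) [IsProbabilityMeasure p] :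
    IsProbabilityMeasure (noisedLaw σ p) :=
  Measure.isProbabilityMeasure_map (by fun_prop)

/-- The transition law has the Gaussian density: both sides have the same characteristic
function. -/
lemma condLaw_eq_withDensity {σ : ℝ} (hσ : 0 < σ) (y : Space D) :
    condLaw σ y =
      (vol D).withDensity fun x => ENNReal.ofReal (kernConst D σ * kern σ (x - y)) := by
  have hc := kernConst_pos (D := D) hσ
  have : IsProbabilityMeasure
      ((vol D).withDensity fun x => ENNReal.ofReal (kernConst D σ * kern σ (x - y))) :=
    ⟨by rw [withDensity_apply _ .univ, setLIntegral_univ, lintegral_kern_sub hσ]⟩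
  apply Measure.ext_of_charFun
  ext t
  have h1 : charFun (condLaw σ y) t
      = Complex.exp (inner ℝ y t * Complex.I) * Complex.exp (-‖σ • t‖ ^ 2 / 2) := by
    rw [← charFun_stdGaussian, charFun_apply, charFun_apply, condLaw,
      integral_map (by fun_prop) (by fun_prop), ← integral_const_mul]
    refine integral_congr_ae (ae_of_all _ fun x => ?_)
    simp only [inner_add_left, inner_smul_left, inner_smul_right, ← Complex.exp_add]
    congr 1
    push_cast
    simp only [conj_trivial]
    ring
  have h2 : charFun
      ((vol D).withDensity fun x => ENNReal.ofReal (kernConst D σ * kern σ (x - y))) t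
      = Complex.exp (inner ℝ y t * Complex.I) * Complex.exp (-‖σ • t‖ ^ 2 / 2) := by
    rw [charFun_apply, integral_withDensity_eq_integral_toReal_smul (by fun_prop) (by simp)]
    rw [← integral_add_right_eq_self _ y]
    have h3 := GaussianFourier.integral_cexp_neg_mul_sq_norm_add (V := Space D)
      (b := (((2 * σ ^ 2)⁻¹ : ℝ) : ℂ)) (by rw [Complex.ofReal_re]; positivity) Complex.I t
    have h4 : ∀ x : Space D,
        (ENNReal.ofReal (kernConst D σ * kern σ (x + y - y))).toReal •
          Complex.exp (inner ℝ (x + y) t * Complex.I) =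
        (kernConst D σ * Complex.exp (inner ℝ y t * Complex.I)) *
          Complex.exp (-(((2 * σ ^ 2)⁻¹ : ℝ) : ℂ) * ‖x‖ ^ 2 + Complex.I * inner ℝ t x) := by
      intro x
      rw [ENNReal.toReal_ofReal (mul_nonneg hc.le (kern_pos _ _).le), Complex.real_smul, kern]
      push_cast
      rw [inner_add_left, mul_assoc, mul_assoc, ← Complex.exp_add, ← Complex.exp_add,
        real_inner_comm t x, add_sub_cancel_right]
      push_cast
      ring_nf
    simp_rw [h4]
    rw [integral_const_mul, h3, kernConst]
    have h5 : (((Real.pi : ℂ) / ((2 * σ ^ 2)⁻¹ : ℝ)) ^ ((Module.finrank ℝ (Space D) : ℂ) / 2))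
        = ((((Real.pi / (2 * σ ^ 2)⁻¹) ^ (D / 2 : ℝ) : ℝ)) : ℂ) := by
      rw [Complex.ofReal_cpow (by positivity)]
      simp
    rw [h5]
    have h6 : ((((Real.pi / (2 * σ ^ 2)⁻¹) ^ (D / 2 : ℝ) : ℝ)) : ℂ) ≠ 0 := by
      rw [Complex.ofReal_ne_zero]; positivity
    have h7 : Complex.I ^ 2 * (‖t‖ : ℂ) ^ 2 / (4 * (((2 * σ ^ 2)⁻¹ : ℝ) : ℂ))
        = -(‖σ • t‖ : ℂ) ^ 2 / 2 := by
      rw [norm_smul, Complex.I_sq, Real.norm_of_nonneg hσ.le]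
      push_cast
      have : (σ : ℂ) ≠ 0 := by exact_mod_cast hσ.ne'
      field_simp
      ring
    rw [h7, Complex.ofReal_inv, mul_comm (_ : ℂ)⁻¹, mul_assoc, ← mul_assoc (_ : ℂ)⁻¹,
      inv_mul_cancel₀ h6, one_mul]
  rw [h1, h2]

/-- Integration against the noised law is iterated integration: first over the noise, then over
the clean data. -/
lemma lintegral_noisedLaw (σ : ℝ) (p : Measure (Space D)) [SFinite p] {f : Space D → ℝ≥0∞}
    (hf : Measurable f) :
    ∫⁻ x, f x ∂(noisedLaw σ p) = ∫⁻ y, ∫⁻ x, f x ∂(condLaw σ y) ∂p := by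
  rw [noisedLaw, lintegral_map hf (by fun_prop), lintegral_prod _ (by fun_prop)]
  refine lintegral_congr fun y => ?_
  rw [condLaw, lintegral_map hf (by fun_prop)]

lemma integrable_kern_sub (σ : ℝ) (p : Measure (Space D)) [IsFiniteMeasure p] (x : Space D) :
    Integrable (fun y => kern σ (x - y)) p := by
  refine Integrable.of_bound (Measurable.aestronglyMeasurable (by fun_prop)) 1
    (ae_of_all _ fun y => ?_)
  rw [Real.norm_of_nonneg (kern_pos _ _).le]
  exact kern_le_one _ _

lemma measurable_evid (p : Measure (Space D)) [SFinite p] :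
    Measurable fun q : ℝ × Space D => evid q.1 p q.2 := by
  unfold evid
  have : StronglyMeasurable fun a : (ℝ × Space D) × Space D => kern a.1.1 (a.1.2 - a.2) :=
    Measurable.stronglyMeasurable (by fun_prop)
  exact this.integral_prod_right.measurable

@[fun_prop]
lemma measurable_evid_comp {Ω : Type*} [MeasurableSpace Ω] {p : Measure (Space D)} [SFinite p]
    {f : Ω → ℝ} {g : Ω → Space D} (hf : Measurable f) (hg : Measurable g) :
    Measurable fun ω => evid (f ω) p (g ω) :=
  (measurable_evid p).comp (hf.prodMk hg)

lemma lintegral_kern_eq_evid {σ : ℝ} (hσ : 0 < σ) (p : Measure (Space D)) [IsFiniteMeasure p]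
    (x : Space D) : ∫⁻ y, ENNReal.ofReal (kernConst D σ * kern σ (x - y)) ∂p =
      ENNReal.ofReal (kernConst D σ * evid σ p x) := by
  rw [← ofReal_integral_eq_lintegral_ofReal ((integrable_kern_sub σ p x).const_mul _)
      (ae_of_all _ fun y => mul_nonneg (kernConst_pos hσ).le (kern_pos _ _).le),
    integral_const_mul, evid]

/-- The noised law has density proportional to the evidence. -/
lemma noisedLaw_eq_withDensity {σ : ℝ} (hσ : 0 < σ) (p : Measure (Space D)) [IsFiniteMeasure p] :
    noisedLaw σ p =
      (vol D).withDensity fun x => ENNReal.ofReal (kernConst D σ * evid σ p x) := by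
  refine Measure.ext_of_lintegral _ fun f hf => ?_
  rw [lintegral_noisedLaw σ p hf, lintegral_withDensity_eq_lintegral_mul _ (by fun_prop) hf]
  simp_rw [condLaw_eq_withDensity hσ]
  have h : ∀ y : Space D, ∫⁻ x, f x ∂((vol D).withDensity fun x =>
      ENNReal.ofReal (kernConst D σ * kern σ (x - y))) =
      ∫⁻ x, ENNReal.ofReal (kernConst D σ * kern σ (x - y)) * f x ∂(vol D) := fun y => by
    rw [lintegral_withDensity_eq_lintegral_mul _ (by fun_prop) hf]; rfl
  simp_rw [h]
  rw [lintegral_lintegral_swap (by fun_prop)]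
  refine lintegral_congr fun x => ?_
  rw [lintegral_mul_const _ (by fun_prop), lintegral_kern_eq_evid hσ]
  rfl

lemma evid_le_one (σ : ℝ) (p : Measure (Space D)) [IsProbabilityMeasure p] (x : Space D) :
    evid σ p x ≤ 1 := by
  have := integral_mono (integrable_kern_sub σ p x) (integrable_const 1)
    (fun y => kern_le_one σ (x - y))
  simpa [evid] using this

lemma evid_pos (σ : ℝ) (p : Measure (Space D)) [IsProbabilityMeasure p] (x : Space D) :
    0 < evid σ p x := by
  rw [evid, integral_pos_iff_support_of_nonneg (fun y => (kern_pos _ _).le)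
    (integrable_kern_sub σ p x)]
  simp [Function.support, (kern_pos _ _).ne']

/-! ### The mixed divergence as an integral of densities -/

/-- The mixture `α p + (1 - α) q`. -/
def mix (α : ℝ) (p q : Measure (Space D)) : Measure (Space D) :=
  ENNReal.ofReal α • p + ENNReal.ofReal (1 - α) • q

lemma isProbabilityMeasure_mix {α : ℝ} (hα : α ∈ Set.Ioc (0 : ℝ) 1) (p q : Measure (Space D))
    [IsProbabilityMeasure p] [IsProbabilityMeasure q] : IsProbabilityMeasure (mix α p q) := by
  refine ⟨?_⟩
  simp only [mix, Measure.coe_add, Measure.coe_smul, Pi.add_apply, Pi.smul_apply, measure_univ,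
    smul_eq_mul, mul_one]
  rw [← ENNReal.ofReal_add hα.1.le (by linarith [hα.2])]
  simp

lemma noisedLaw_mix (α σ : ℝ) (p q : Measure (Space D)) [IsFiniteMeasure p] [IsFiniteMeasure q] :
    noisedLaw σ (mix α p q) =
      ENNReal.ofReal α • noisedLaw σ p + ENNReal.ofReal (1 - α) • noisedLaw σ q := by
  rw [noisedLaw, mix, Measure.add_prod, Measure.map_add _ _ (by fun_prop), Measure.prod_smul_left,
    Measure.prod_smul_left, Measure.map_smul, Measure.map_smul]
  rfl

lemma evid_mix {α : ℝ} (hα : α ∈ Set.Ioc (0 : ℝ) 1) (σ : ℝ) (p q : Measure (Space D))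
    [IsFiniteMeasure p] [IsFiniteMeasure q] (x : Space D) :
    evid σ (mix α p q) x = α * evid σ p x + (1 - α) * evid σ q x := by
  have h1 := (integrable_kern_sub σ p x).smul_measure (c := ENNReal.ofReal α) (by simp)
  have h2 := (integrable_kern_sub σ q x).smul_measure (c := ENNReal.ofReal (1 - α)) (by simp)
  rw [evid, mix, integral_add_measure h1 h2, integral_smul_measure, integral_smul_measure,
    ENNReal.toReal_ofReal hα.1.le, ENNReal.toReal_ofReal (by linarith [hα.2])]
  rfl

/-- The pointwise relative entropy `a log (a / b) + b - a`. -/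
def relEnt (a b : ℝ) : ℝ := a * Real.log (a / b) + b - a

lemma relEnt_eq_mul_klFun {a b : ℝ} (hb : 0 < b) : relEnt a b = b * klFun (a / b) := by
  rw [relEnt, klFun_apply]; field_simp

lemma relEnt_nonneg {a b : ℝ} (ha : 0 < a) (hb : 0 < b) : 0 ≤ relEnt a b := by
  rw [relEnt_eq_mul_klFun hb]
  exact mul_nonneg hb.le (klFun_nonneg (by positivity))

@[fun_prop]
lemma measurable_relEnt_comp {Ω : Type*} [MeasurableSpace Ω] {f g : Ω → ℝ} (hf : Measurable f)
    (hg : Measurable g) : Measurable fun ω => relEnt (f ω) (g ω) := by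
  unfold relEnt; fun_prop

lemma klDiv_noisedLaw {σ : ℝ} (hσ : 0 < σ) (p q : Measure (Space D)) [IsProbabilityMeasure p]
    [IsProbabilityMeasure q] : klDiv (noisedLaw σ p) (noisedLaw σ q) =
      ∫⁻ x, ENNReal.ofReal (kernConst D σ * relEnt (evid σ p x) (evid σ q x)) ∂(vol D) := by
  have hc := kernConst_pos (D := D) hσ
  have h : noisedLaw σ p = (noisedLaw σ q).withDensity
      fun x => ENNReal.ofReal (evid σ p x / evid σ q x) := by
    rw [noisedLaw_eq_withDensity hσ p, noisedLaw_eq_withDensity hσ q,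
      ← withDensity_mul _ (by fun_prop) (by fun_prop)]
    congr 1
    ext x
    have := evid_pos σ q x
    rw [Pi.mul_apply, ← ENNReal.ofReal_mul (by positivity)]
    congr 1
    field_simp
  have hac : noisedLaw σ p ≪ noisedLaw σ q := h ▸ withDensity_absolutelyContinuous _ _
  rw [klDiv_eq_lintegral_klFun_of_ac hac]
  have h2 : (noisedLaw σ p).rnDeriv (noisedLaw σ q) =ᵐ[noisedLaw σ q]
      fun x => ENNReal.ofReal (evid σ p x / evid σ q x) := by
    conv_lhs => rw [h]
    exact Measure.rnDeriv_withDensity _ (by fun_prop)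
  have h3 : ∫⁻ x, ENNReal.ofReal (klFun ((noisedLaw σ p).rnDeriv (noisedLaw σ q) x).toReal)
        ∂(noisedLaw σ q) =
      ∫⁻ x, ENNReal.ofReal (klFun (evid σ p x / evid σ q x)) ∂(noisedLaw σ q) := by
    refine lintegral_congr_ae (h2.mono fun x hx => ?_)
    simp only [hx]
    rw [ENNReal.toReal_ofReal (div_nonneg (evid_pos _ _ _).le (evid_pos _ _ _).le)]
  rw [h3, noisedLaw_eq_withDensity hσ q, lintegral_withDensity_eq_lintegral_mul _ (by fun_prop)
    (by fun_prop)]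
  refine lintegral_congr fun x => ?_
  have := evid_pos σ q x
  rw [Pi.mul_apply, ← ENNReal.ofReal_mul (by positivity), relEnt_eq_mul_klFun this, mul_assoc]

lemma mixedKL_eq_lintegral {α : ℝ} (hα : α ∈ Set.Ioc (0 : ℝ) 1) {σ : ℝ} (hσ : 0 < σ)
    (p q : Measure (Space D)) [IsProbabilityMeasure p] [IsProbabilityMeasure q] :
    mixedKL α σ p q =
      ∫⁻ x, ENNReal.ofReal (kernConst D σ * relEnt (evid σ (mix α p q) x) (evid σ q x))
        ∂(vol D) := by
  have := isProbabilityMeasure_mix hα p q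
  rw [mixedKL, ← noisedLaw_mix, klDiv_noisedLaw hσ]

/-! ### Bounds on the evidence and on the score -/

/-- The score `∇ log (evid σ p)`, as the posterior mean of the conditional score. -/
def score (σ : ℝ) (p : Measure (Space D)) (x : Space D) : Space D :=
  (evid σ p x)⁻¹ • ∫ y, kern σ (x - y) • condScore σ y x ∂p

@[fun_prop]
lemma measurable_condScore_comp {Ω : Type*} [MeasurableSpace Ω] {f : Ω → ℝ} {g h : Ω → Space D}
    (hf : Measurable f) (hg : Measurable g) (hh : Measurable h) :
    Measurable fun ω => condScore (f ω) (g ω) (h ω) := by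
  unfold condScore; fun_prop

lemma measurable_score (p : Measure (Space D)) [SFinite p] :
    Measurable fun q : ℝ × Space D => score q.1 p q.2 := by
  unfold score
  have : StronglyMeasurable fun a : (ℝ × Space D) × Space D =>
      kern a.1.1 (a.1.2 - a.2) • condScore a.1.1 a.2 a.1.2 :=
    Measurable.stronglyMeasurable (by fun_prop)
  exact ((measurable_evid p).inv).smul this.integral_prod_right.measurable

@[fun_prop]
lemma measurable_score_comp {Ω : Type*} [MeasurableSpace Ω] {p : Measure (Space D)} [SFinite p]
    {f : Ω → ℝ} {g : Ω → Space D} (hf : Measurable f) (hg : Measurable g) :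
    Measurable fun ω => score (f ω) p (g ω) := by
  have h := (measurable_score p).comp (hf.prodMk hg)
  simpa only [Function.comp_def] using h

lemma log_kern (σ : ℝ) (x : Space D) : Real.log (kern σ x) = -((2 * σ ^ 2)⁻¹ * ‖x‖ ^ 2) :=
  Real.log_exp _

lemma kern_mul_sq_le {σ : ℝ} (hσ : 0 < σ) (x : Space D) : kern σ x * ‖x‖ ^ 2 ≤ 2 * σ ^ 2 := by
  set a := (2 * σ ^ 2)⁻¹ * ‖x‖ ^ 2 with ha
  have h1 : a * Real.exp (-a) ≤ 1 := by
    rw [Real.exp_neg, ← div_eq_mul_inv, div_le_one (Real.exp_pos _)]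
    linarith [Real.add_one_le_exp a]
  have h2 : ‖x‖ ^ 2 = 2 * σ ^ 2 * a := by rw [ha]; field_simp
  have h3 : kern σ x = Real.exp (-a) := rfl
  rw [h2, h3]
  nlinarith [sq_nonneg σ]

lemma norm_condScore {σ : ℝ} (hσ : 0 < σ) (y x : Space D) :
    ‖condScore σ y x‖ = (σ ^ 2)⁻¹ * ‖x - y‖ := by
  rw [condScore, norm_neg, norm_smul, Real.norm_of_nonneg (by positivity)]

lemma kern_mul_norm_condScore_sq_le {σ : ℝ} (hσ : 0 < σ) (y x : Space D) :
    kern σ (x - y) * ‖condScore σ y x‖ ^ 2 ≤ 2 * (σ ^ 2)⁻¹ := by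
  have h := kern_mul_sq_le hσ (x - y)
  rw [norm_condScore hσ, mul_pow]
  calc kern σ (x - y) * ((σ ^ 2)⁻¹ ^ 2 * ‖x - y‖ ^ 2)
      = (σ ^ 2)⁻¹ ^ 2 * (kern σ (x - y) * ‖x - y‖ ^ 2) := by ring
    _ ≤ (σ ^ 2)⁻¹ ^ 2 * (2 * σ ^ 2) := by gcongr
    _ = 2 * (σ ^ 2)⁻¹ := by field_simp

lemma norm_kern_smul_condScore_le {σ : ℝ} (hσ : 0 < σ) (y x : Space D) :
    ‖kern σ (x - y) • condScore σ y x‖ ≤ 1 + 2 * (σ ^ 2)⁻¹ := by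
  have h := kern_mul_norm_condScore_sq_le hσ y x
  have h1 := kern_le_one σ (x - y)
  have h0 := kern_pos σ (x - y)
  rw [norm_smul, Real.norm_of_nonneg h0.le]
  nlinarith [sq_nonneg (‖condScore σ y x‖ - 1), sq_nonneg (‖condScore σ y x‖)]

lemma integrable_kern_smul_condScore {σ : ℝ} (hσ : 0 < σ) (p : Measure (Space D))
    [IsFiniteMeasure p] (x : Space D) :
    Integrable (fun y => kern σ (x - y) • condScore σ y x) p :=
  Integrable.of_bound (Measurable.aestronglyMeasurable (by fun_prop)) _
    (ae_of_all _ fun y => norm_kern_smul_condScore_le hσ y x)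

lemma hasGradientAt_kern_sub {σ : ℝ} (hσ : 0 < σ) (y x : Space D) :
    HasGradientAt (fun x => kern σ (x - y)) (kern σ (x - y) • condScore σ y x) x := by
  have h1 : HasFDerivAt (fun x : Space D => ‖x - y‖ ^ 2)
      (2 • (innerSL ℝ (x - y)).comp (ContinuousLinearMap.id ℝ (Space D))) x :=
    ((hasFDerivAt_id x).sub_const y).norm_sq
  have h2 := ((h1.const_mul (2 * σ ^ 2)⁻¹).neg).exp
  rw [hasGradientAt_iff_hasFDerivAt]
  change HasFDerivAt (fun x => kern σ (x - y)) _ x at h2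
  refine h2.congr_fderiv ?_
  ext u
  simp only [InnerProductSpace.toDual_apply_apply, condScore, inner_smul_left, inner_neg_left,
    smul_apply, neg_apply, smul_eq_mul, conj_trivial,
    ContinuousLinearMap.comp_apply, innerSL_apply_apply, ContinuousLinearMap.id_apply, kern]
  simp only [Pi.neg_apply, nsmul_eq_mul]
  field_simp
  push_cast
  ring

lemma hasGradientAt_evid {σ : ℝ} (hσ : 0 < σ) (p : Measure (Space D)) [IsFiniteMeasure p]
    (x : Space D) :
    HasGradientAt (evid σ p) (∫ y, kern σ (x - y) • condScore σ y x ∂p) x := by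
  rw [hasGradientAt_iff_hasFDerivAt]
  have h := hasFDerivAt_integral_of_dominated_of_fderiv_le (μ := p) (s := Set.univ)
    (F := fun x y => kern σ (x - y))
    (F' := fun x y => InnerProductSpace.toDual ℝ (Space D) (kern σ (x - y) • condScore σ y x))
    (x₀ := x) (bound := fun _ => 1 + 2 * (σ ^ 2)⁻¹) univ_mem
    (Eventually.of_forall fun x => Measurable.aestronglyMeasurable (by fun_prop))
    (integrable_kern_sub σ p x)
    ((LinearIsometryEquiv.continuous _).comp_aestronglyMeasurable
      (integrable_kern_smul_condScore hσ p x).1)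
    (ae_of_all _ fun y x _ => by
      rw [LinearIsometryEquiv.norm_map]; exact norm_kern_smul_condScore_le hσ y x)
    (integrable_const _)
    (ae_of_all _ fun y x _ => (hasGradientAt_kern_sub hσ y x).hasFDerivAt)
  refine h.congr_fderiv ?_
  exact (InnerProductSpace.toDual ℝ (Space D)).toContinuousLinearEquiv.integral_comp_comm
    (fun y => kern σ (x - y) • condScore σ y x)

lemma hasGradientAt_log_evid {σ : ℝ} (hσ : 0 < σ) (p : Measure (Space D)) [IsProbabilityMeasure p]
    (x : Space D) : HasGradientAt (fun x => Real.log (evid σ p x)) (score σ p x) x := by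
  have h := (hasGradientAt_evid hσ p x).hasFDerivAt.log (evid_pos σ p x).ne'
  rw [hasGradientAt_iff_hasFDerivAt]
  refine h.congr_fderiv ?_
  rw [score, map_smul]

lemma exists_half_le_measureReal_closedBall (p : Measure (Space D)) [IsProbabilityMeasure p] :
    ∃ R : ℝ, 0 ≤ R ∧ 1 / 2 ≤ p.real (Metric.closedBall 0 R) := by
  have h : Tendsto (fun n : ℕ => p.real (Metric.closedBall (0 : Space D) n)) atTop
      (𝓝 (p.real (⋃ n : ℕ, Metric.closedBall (0 : Space D) n))) := by
    refine (ENNReal.tendsto_toReal (measure_ne_top _ _)).comp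
      (tendsto_measure_iUnion_atTop fun a b hab => ?_)
    exact Metric.closedBall_subset_closedBall (by exact_mod_cast hab)
  rw [Metric.iUnion_closedBall_nat, probReal_univ] at h
  obtain ⟨n, hn⟩ := (h.eventually (eventually_ge_nhds (by norm_num : (1 / 2 : ℝ) < 1))).exists
  exact ⟨n, by positivity, hn⟩

/-- If the prior gives mass at least `1/2` to the ball of radius `R`, the evidence is at least half
of the smallest value of the kernel on that ball. -/
lemma le_evid {σ R : ℝ} {p : Measure (Space D)} [IsProbabilityMeasure p]
    (hp : 1 / 2 ≤ p.real (Metric.closedBall 0 R)) (x : Space D) :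
    1 / 2 * Real.exp (-((2 * σ ^ 2)⁻¹ * (‖x‖ + R) ^ 2)) ≤ evid σ p x := by
  have h1 : ∫ y in Metric.closedBall 0 R, Real.exp (-((2 * σ ^ 2)⁻¹ * (‖x‖ + R) ^ 2)) ∂p ≤
      ∫ y in Metric.closedBall 0 R, kern σ (x - y) ∂p := by
    refine setIntegral_mono_on (integrable_const _).integrableOn
      (integrable_kern_sub σ p x).integrableOn measurableSet_closedBall fun y hy => ?_
    rw [mem_closedBall_zero_iff] at hy
    have : ‖x - y‖ ≤ ‖x‖ + R := (norm_sub_le _ _).trans (by linarith)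
    unfold kern
    gcongr
  have h2 : ∫ y in Metric.closedBall 0 R, kern σ (x - y) ∂p ≤ evid σ p x :=
    setIntegral_le_integral (integrable_kern_sub σ p x) (ae_of_all _ fun y => (kern_pos _ _).le)
  rw [setIntegral_const, smul_eq_mul] at h1
  have := Real.exp_pos (-((2 * σ ^ 2)⁻¹ * (‖x‖ + R) ^ 2))
  nlinarith

lemma neg_log_evid_le {σ R : ℝ} {p : Measure (Space D)} [IsProbabilityMeasure p]
    (hp : 1 / 2 ≤ p.real (Metric.closedBall 0 R)) (x : Space D) :
    -Real.log (evid σ p x) ≤ Real.log 2 + (2 * σ ^ 2)⁻¹ * (‖x‖ + R) ^ 2 := by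
  have h := Real.log_le_log (by positivity) (le_evid (σ := σ) hp x)
  rw [Real.log_mul (by norm_num) (Real.exp_pos _).ne', Real.log_exp, one_div, Real.log_inv] at h
  linarith

lemma log_evid_nonpos (σ : ℝ) (p : Measure (Space D)) [IsProbabilityMeasure p] (x : Space D) :
    Real.log (evid σ p x) ≤ 0 :=
  Real.log_nonpos (evid_pos _ _ _).le (evid_le_one _ _ _)

/-- The posterior second moment of `x - y` is controlled by the log-evidence: the posterior has
density `kern / evid` with respect to the prior, and its relative entropy is nonnegative. -/
lemma integral_kern_mul_sq_le {σ : ℝ} (hσ : 0 < σ) (p : Measure (Space D))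
    [IsProbabilityMeasure p] (x : Space D) :
    ∫ y, kern σ (x - y) * ‖x - y‖ ^ 2 ∂p ≤
      2 * σ ^ 2 * (evid σ p x * -Real.log (evid σ p x)) := by
  have hZ := evid_pos σ p x
  have hi := integrable_kern_sub σ p x
  have h : ∀ y, kern σ (x - y) * ‖x - y‖ ^ 2 ≤ 2 * σ ^ 2 *
      (kern σ (x - y) * -Real.log (evid σ p x) + (evid σ p x - kern σ (x - y))) := by
    intro y
    have hk := kern_pos σ (x - y)
    have := relEnt_nonneg hk hZ
    rw [relEnt, Real.log_div hk.ne' hZ.ne', log_kern] at this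
    have e : kern σ (x - y) * ‖x - y‖ ^ 2 =
        2 * σ ^ 2 * (kern σ (x - y) * ((2 * σ ^ 2)⁻¹ * ‖x - y‖ ^ 2)) := by field_simp
    rw [e]
    gcongr
    linarith
  have hi2 : Integrable (fun y => kern σ (x - y) * ‖x - y‖ ^ 2) p := by
    refine Integrable.of_bound (Measurable.aestronglyMeasurable (by fun_prop)) (2 * σ ^ 2)
      (ae_of_all _ fun y => ?_)
    rw [Real.norm_of_nonneg (mul_nonneg (kern_pos _ _).le (sq_nonneg _))]
    exact kern_mul_sq_le hσ _
  have hi3 : Integrable (fun y => evid σ p x - kern σ (x - y)) p := (integrable_const _).sub hi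
  refine (integral_mono hi2 (((hi.mul_const _).add hi3).const_mul _) h).trans_eq ?_
  rw [integral_const_mul, integral_add' (hi.mul_const _) hi3, integral_mul_const,
    integral_sub (integrable_const _) hi]
  simp [evid]

/-- The score grows at most linearly, uniformly over all priors with mass at least `1/2` in the
ball of radius `R`. -/
lemma norm_score_le {σ R : ℝ} (hσ : 0 < σ) (hR : 0 ≤ R) {p : Measure (Space D)}
    [IsProbabilityMeasure p] (hp : 1 / 2 ≤ p.real (Metric.closedBall 0 R)) (x : Space D) :
    ‖score σ p x‖ ≤ (σ ^ 2)⁻¹ * (‖x‖ + R + 2 * σ) := by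
  have hZ := evid_pos σ p x
  set A := ‖x‖ + R + 2 * σ with hA
  have hA0 : 0 < A := by positivity
  have hi := integrable_kern_sub σ p x
  have hi2 : Integrable (fun y => kern σ (x - y) * ‖x - y‖ ^ 2) p := by
    refine Integrable.of_bound (Measurable.aestronglyMeasurable (by fun_prop)) (2 * σ ^ 2)
      (ae_of_all _ fun y => ?_)
    rw [Real.norm_of_nonneg (mul_nonneg (kern_pos _ _).le (sq_nonneg _))]
    exact kern_mul_sq_le hσ _
  have hlog : 2 * σ ^ 2 * -Real.log (evid σ p x) ≤ A ^ 2 := by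
    have h := neg_log_evid_le (σ := σ) hp x
    have h2 : Real.log 2 ≤ 1 := by linarith [Real.log_two_lt_d9]
    calc 2 * σ ^ 2 * -Real.log (evid σ p x)
        ≤ 2 * σ ^ 2 * (1 + (2 * σ ^ 2)⁻¹ * (‖x‖ + R) ^ 2) := by gcongr; linarith
      _ = 2 * σ ^ 2 + (‖x‖ + R) ^ 2 := by field_simp
      _ ≤ A ^ 2 := by rw [hA]; nlinarith [norm_nonneg x, mul_nonneg hσ.le (norm_nonneg x),
                    mul_nonneg hσ.le hR]
  -- `‖v‖ ≤ (‖v‖² / A + A) / 2` turns the second moment into a first moment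
  have h1 : ‖∫ y, kern σ (x - y) • condScore σ y x ∂p‖ ≤
      ∫ y, (σ ^ 2)⁻¹ *
        ((2 * A)⁻¹ * (kern σ (x - y) * ‖x - y‖ ^ 2) + A / 2 * kern σ (x - y)) ∂p := by
    refine norm_integral_le_of_norm_le
      (((hi2.const_mul _).add (hi.const_mul _)).const_mul _) (ae_of_all _ fun y => ?_)
    rw [norm_smul, Real.norm_of_nonneg (kern_pos _ _).le, norm_condScore hσ]
    have hk := kern_pos σ (x - y)
    have e : (2 * A)⁻¹ * (kern σ (x - y) * ‖x - y‖ ^ 2) + A / 2 * kern σ (x - y) =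
      kern σ (x - y) * ((2 * A)⁻¹ * ‖x - y‖ ^ 2 + A / 2) := by ring
    rw [e, mul_left_comm]
    gcongr
    have : (2 * A)⁻¹ * ‖x - y‖ ^ 2 + A / 2 - ‖x - y‖ = (2 * A)⁻¹ * (‖x - y‖ - A) ^ 2 := by
      field_simp; ring
    have h3 : 0 ≤ (2 * A)⁻¹ * (‖x - y‖ - A) ^ 2 := by positivity
    linarith
  rw [integral_const_mul, integral_add (hi2.const_mul _) (hi.const_mul _), integral_const_mul,
    integral_const_mul] at h1
  change _ ≤ (σ ^ 2)⁻¹ * ((2 * A)⁻¹ * _ + A / 2 * evid σ p x) at h1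
  have h4 := integral_kern_mul_sq_le hσ p x
  have h5 : ∫ y, kern σ (x - y) * ‖x - y‖ ^ 2 ∂p ≤ evid σ p x * A ^ 2 := by nlinarith
  rw [score, norm_smul, norm_inv, Real.norm_of_nonneg hZ.le]
  calc (evid σ p x)⁻¹ * ‖∫ y, kern σ (x - y) • condScore σ y x ∂p‖
      ≤ (evid σ p x)⁻¹ * ((σ ^ 2)⁻¹ * ((2 * A)⁻¹ * (evid σ p x * A ^ 2) +
          A / 2 * evid σ p x)) := by
        gcongr; exact h1.trans (by gcongr)
    _ = (σ ^ 2)⁻¹ * A := by field_simp; ring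

/-! ### The log-likelihood ratio -/

/-- The logarithm of the density of the noised law of `p` relative to that of `q`. -/
def logRatio (σ : ℝ) (p q : Measure (Space D)) (x : Space D) : ℝ :=
  Real.log (evid σ p x) - Real.log (evid σ q x)

@[fun_prop]
lemma measurable_logRatio_comp {Ω : Type*} [MeasurableSpace Ω] {p q : Measure (Space D)}
    [SFinite p] [SFinite q] {f : Ω → ℝ} {g : Ω → Space D} (hf : Measurable f)
    (hg : Measurable g) : Measurable fun ω => logRatio (f ω) p q (g ω) := by
  unfold logRatio; fun_prop

lemma hasGradientAt_logRatio {σ : ℝ} (hσ : 0 < σ) (p q : Measure (Space D))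
    [IsProbabilityMeasure p] [IsProbabilityMeasure q] (x : Space D) :
    HasGradientAt (logRatio σ p q) (score σ p x - score σ q x) x := by
  have h := (hasGradientAt_log_evid hσ p x).hasFDerivAt.sub
    (hasGradientAt_log_evid hσ q x).hasFDerivAt
  rw [hasGradientAt_iff_hasFDerivAt, map_sub]
  exact h

lemma abs_logRatio_le {σ R : ℝ} {p q : Measure (Space D)} [IsProbabilityMeasure p]
    [IsProbabilityMeasure q] (hp : 1 / 2 ≤ p.real (Metric.closedBall 0 R))
    (hq : 1 / 2 ≤ q.real (Metric.closedBall 0 R)) (x : Space D) :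
    |logRatio σ p q x| ≤ Real.log 2 + (2 * σ ^ 2)⁻¹ * (‖x‖ + R) ^ 2 := by
  have h1 := neg_log_evid_le (σ := σ) hp x
  have h2 := neg_log_evid_le (σ := σ) hq x
  have h3 := log_evid_nonpos σ p x
  have h4 := log_evid_nonpos σ q x
  rw [abs_le, logRatio]
  constructor <;> linarith

lemma norm_score_sub_score_le {σ R : ℝ} (hσ : 0 < σ) (hR : 0 ≤ R) {p q : Measure (Space D)}
    [IsProbabilityMeasure p] [IsProbabilityMeasure q]
    (hp : 1 / 2 ≤ p.real (Metric.closedBall 0 R))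
    (hq : 1 / 2 ≤ q.real (Metric.closedBall 0 R)) (x : Space D) :
    ‖score σ p x - score σ q x‖ ≤ 2 * (σ ^ 2)⁻¹ * (‖x‖ + R + 2 * σ) := by
  have h1 := norm_score_le hσ hR hp x
  have h2 := norm_score_le hσ hR hq x
  have h3 := norm_sub_le (score σ p x) (score σ q x)
  linarith

lemma abs_logRatio_sub_le {σ R M : ℝ} (hσ : 0 < σ) (hR : 0 ≤ R) {p q : Measure (Space D)}
    [IsProbabilityMeasure p] [IsProbabilityMeasure q]
    (hp : 1 / 2 ≤ p.real (Metric.closedBall 0 R))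
    (hq : 1 / 2 ≤ q.real (Metric.closedBall 0 R)) {x y : Space D} (hx : ‖x‖ ≤ M)
    (hy : ‖y‖ ≤ M) :
    |logRatio σ p q y - logRatio σ p q x| ≤ 2 * (σ ^ 2)⁻¹ * (M + R + 2 * σ) * ‖y - x‖ := by
  rw [← Real.norm_eq_abs]
  refine (convex_closedBall (0 : Space D) M).norm_image_sub_le_of_norm_hasFDerivWithin_le
    (f' := fun z => InnerProductSpace.toDual ℝ _ (score σ p z - score σ q z))
    (fun z _ => (hasGradientAt_logRatio hσ p q z).hasFDerivAt.hasFDerivWithinAt)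
    (fun z hz => ?_) (by simpa using hx) (by simpa using hy)
  rw [LinearIsometryEquiv.norm_map]
  refine (norm_score_sub_score_le hσ hR hp hq z).trans ?_
  rw [mem_closedBall_zero_iff] at hz
  gcongr

/-! ### Minimizers of the denoising loss -/

lemma integrable_kern_mul_norm_sub_condScore_sq {σ : ℝ} (hσ : 0 < σ) (p : Measure (Space D))
    [IsFiniteMeasure p] (x a : Space D) :
    Integrable (fun y => kern σ (x - y) * ‖a - condScore σ y x‖ ^ 2) p := by
  refine Integrable.of_bound (Measurable.aestronglyMeasurable (by fun_prop))
    (2 * ‖a‖ ^ 2 + 2 * (2 * (σ ^ 2)⁻¹)) (ae_of_all _ fun y => ?_)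
  have h0 := kern_pos σ (x - y)
  have h1 := kern_le_one σ (x - y)
  have h2 := kern_mul_norm_condScore_sq_le hσ y x
  rw [Real.norm_of_nonneg (mul_nonneg h0.le (sq_nonneg _))]
  have h3 : ‖a - condScore σ y x‖ ^ 2 ≤ 2 * ‖a‖ ^ 2 + 2 * ‖condScore σ y x‖ ^ 2 := by
    have h4 := norm_sub_le a (condScore σ y x)
    nlinarith [sq_nonneg (‖a‖ - ‖condScore σ y x‖), norm_nonneg (a - condScore σ y x)]
  calc kern σ (x - y) * ‖a - condScore σ y x‖ ^ 2
      ≤ kern σ (x - y) * (2 * ‖a‖ ^ 2 + 2 * ‖condScore σ y x‖ ^ 2) := by gcongr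
    _ = kern σ (x - y) * (2 * ‖a‖ ^ 2) + 2 * (kern σ (x - y) * ‖condScore σ y x‖ ^ 2) := by ring
    _ ≤ 1 * (2 * ‖a‖ ^ 2) + 2 * (2 * (σ ^ 2)⁻¹) := by gcongr
    _ = _ := by ring

/-- Pythagoras at a fixed noisy point: the score is the posterior mean of the conditional
score. -/
lemma integral_kern_mul_norm_sub_condScore_sq {σ : ℝ} (hσ : 0 < σ) (p : Measure (Space D))
    [IsProbabilityMeasure p] (x a : Space D) :
    ∫ y, kern σ (x - y) * ‖a - condScore σ y x‖ ^ 2 ∂p =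
      ‖a - score σ p x‖ ^ 2 * evid σ p x +
        ∫ y, kern σ (x - y) * ‖score σ p x - condScore σ y x‖ ^ 2 ∂p := by
  set m := score σ p x with hm
  have hi := integrable_kern_sub σ p x
  have hc := integrable_kern_smul_condScore hσ p x
  have hcross : ∫ y, inner ℝ (a - m) (kern σ (x - y) • m - kern σ (x - y) • condScore σ y x) ∂p
      = 0 := by
    rw [integral_inner (f := fun y => kern σ (x - y) • m - kern σ (x - y) • condScore σ y x)
      ((hi.smul_const m).sub hc), integral_sub (hi.smul_const m) hc,
      integral_smul_const]
    change inner ℝ _ (evid σ p x • m - _) = 0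
    rw [hm, score, smul_smul, mul_inv_cancel₀ (evid_pos σ p x).ne', one_smul, sub_self,
      inner_zero_right]
  have hci : Integrable (fun y => inner ℝ (a - m)
      (kern σ (x - y) • m - kern σ (x - y) • condScore σ y x)) p :=
    ((hi.smul_const m).sub hc).const_inner _
  have h : ∀ y, kern σ (x - y) * ‖a - condScore σ y x‖ ^ 2 =
      (‖a - m‖ ^ 2 * kern σ (x - y) +
        2 * inner ℝ (a - m) (kern σ (x - y) • m - kern σ (x - y) • condScore σ y x)) +
      kern σ (x - y) * ‖m - condScore σ y x‖ ^ 2 := by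
    intro y
    have e : a - condScore σ y x = (a - m) + (m - condScore σ y x) := by abel
    rw [e, norm_add_sq_real, ← smul_sub, inner_smul_right]
    ring
  simp_rw [h]
  rw [integral_add (f := fun y => ‖a - m‖ ^ 2 * kern σ (x - y) +
      2 * inner ℝ (a - m) (kern σ (x - y) • m - kern σ (x - y) • condScore σ y x))
    ((hi.const_mul _).add (hci.const_mul 2)) (integrable_kern_mul_norm_sub_condScore_sq hσ p x m),
    integral_add (hi.const_mul _) (hci.const_mul 2), integral_const_mul, integral_const_mul,
    hcross, mul_zero, add_zero, evid]

/-- The excess loss at a fixed time is a weighted squared distance to the score. -/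
lemma lintegral_condLaw_eq_add {σ w : ℝ} (hσ : 0 < σ) (hw : 0 ≤ w) (p : Measure (Space D))
    [IsProbabilityMeasure p] {f : Space D → Space D} (hf : Measurable f) :
    ∫⁻ y, ∫⁻ x, ENNReal.ofReal (w * ‖f x - condScore σ y x‖ ^ 2) ∂(condLaw σ y) ∂p =
      ∫⁻ x, ENNReal.ofReal (w * kernConst D σ * (‖f x - score σ p x‖ ^ 2 * evid σ p x)) ∂(vol D) +
      ∫⁻ y, ∫⁻ x, ENNReal.ofReal (w * ‖score σ p x - condScore σ y x‖ ^ 2)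
        ∂(condLaw σ y) ∂p := by
  have hc := kernConst_pos (D := D) hσ
  have key : ∀ g : Space D → Space D, Measurable g →
      ∫⁻ y, ∫⁻ x, ENNReal.ofReal (w * ‖g x - condScore σ y x‖ ^ 2) ∂(condLaw σ y) ∂p =
      ∫⁻ x, ENNReal.ofReal (w * kernConst D σ *
        ∫ y, kern σ (x - y) * ‖g x - condScore σ y x‖ ^ 2 ∂p) ∂(vol D) := by
    intro g hg
    have h1 : ∀ y, ∫⁻ x, ENNReal.ofReal (w * ‖g x - condScore σ y x‖ ^ 2) ∂(condLaw σ y) =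
        ∫⁻ x, ENNReal.ofReal
          (w * kernConst D σ * (kern σ (x - y) * ‖g x - condScore σ y x‖ ^ 2)) ∂(vol D) := by
      intro y
      rw [condLaw_eq_withDensity hσ, lintegral_withDensity_eq_lintegral_mul _ (by fun_prop)
        (by fun_prop)]
      refine lintegral_congr fun x => ?_
      rw [Pi.mul_apply, ← ENNReal.ofReal_mul (mul_nonneg hc.le (kern_pos _ _).le)]
      congr 1; ring
    simp_rw [h1]
    rw [lintegral_lintegral_swap (by fun_prop)]
    refine lintegral_congr fun x => ?_
    rw [← integral_const_mul, ofReal_integral_eq_lintegral_ofReal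
      ((integrable_kern_mul_norm_sub_condScore_sq hσ p x (g x)).const_mul _)
      (ae_of_all _ fun y => mul_nonneg (by positivity)
        (mul_nonneg (kern_pos _ _).le (sq_nonneg _)))]
  rw [key f hf, key _ (by fun_prop), ← lintegral_add_left (f := fun x =>
    ENNReal.ofReal (w * kernConst D σ * (‖f x - score σ p x‖ ^ 2 * evid σ p x))) (by fun_prop)]
  refine lintegral_congr fun x => ?_
  rw [integral_kern_mul_norm_sub_condScore_sq hσ p x (f x), mul_add, ENNReal.ofReal_add]
  · exact mul_nonneg (by positivity) (mul_nonneg (sq_nonneg _) (evid_pos _ _ _).le)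
  · exact mul_nonneg (by positivity) (integral_nonneg fun y =>
      mul_nonneg (kern_pos _ _).le (sq_nonneg _))

/-- A minimizer of the denoising loss is the score at almost every time and place. -/
lemma ae_eq_score_of_isArgmin {τ : Measure ℝ} [SFinite τ] {w σ : ℝ → ℝ} (hw : Measurable w)
    (hσ : Measurable σ) (hσ_pos : ∀ᵐ t ∂τ, 0 < σ t) (hw_pos : ∀ᵐ t ∂τ, 0 < w t)
    {p : Measure (Space D)} [IsProbabilityMeasure p] {s : ℝ → Space D → Space D}
    (hs : IsArgmin (dsmLoss τ w σ p) s) :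
    ∀ᵐ t ∂τ, ∀ᵐ x ∂(vol D), s t x = score (σ t) p x := by
  obtain ⟨hsm, hfin, hmin⟩ := hs
  have hst : Measurable fun q : ℝ × Space D => s q.1 q.2 := hsm
  set e : ℝ → ℝ≥0∞ := fun t => ∫⁻ x, ENNReal.ofReal
    (w t * kernConst D (σ t) * (‖s t x - score (σ t) p x‖ ^ 2 * evid (σ t) p x)) ∂(vol D) with he
  have hem : Measurable e := by
    refine Measurable.lintegral_prod_right' (f := fun q : ℝ × Space D => ENNReal.ofReal
      (w q.1 * kernConst D (σ q.1) *
        (‖s q.1 q.2 - score (σ q.1) p q.2‖ ^ 2 * evid (σ q.1) p q.2))) ?_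
    fun_prop
  have hsplit : dsmLoss τ w σ p s =
      ∫⁻ t, e t ∂τ + dsmLoss τ w σ p (fun t x => score (σ t) p x) := by
    rw [dsmLoss, dsmLoss, ← lintegral_add_left hem]
    refine lintegral_congr_ae ?_
    filter_upwards [hσ_pos, hw_pos] with t ht hwt
    exact lintegral_condLaw_eq_add ht hwt.le p (f := s t) (hst.comp measurable_prodMk_left)
  have hle := hmin (fun t x => score (σ t) p x)
    (by simp only [Function.uncurry_def]; fun_prop)
  have hzero : ∫⁻ t, e t ∂τ = 0 := by
    have h1 : dsmLoss τ w σ p (fun t x => score (σ t) p x) ≠ ∞ := by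
      intro h
      rw [h, add_top] at hsplit
      exact hfin hsplit
    rw [hsplit] at hle
    by_contra hne
    exact absurd hle (not_le.2 ((ENNReal.lt_add_right h1 hne).trans_eq (add_comm _ _)))
  rw [lintegral_eq_zero_iff hem] at hzero
  filter_upwards [hzero, hσ_pos, hw_pos] with t h0 ht hwt
  have hst' : Measurable (s t) := hst.comp measurable_prodMk_left
  rw [he, Pi.zero_apply, lintegral_eq_zero_iff (by fun_prop)] at h0
  filter_upwards [h0] with x hx
  have hc := kernConst_pos (D := D) ht
  have hZ := evid_pos (σ t) p x
  rw [Pi.zero_apply, ENNReal.ofReal_eq_zero] at hx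
  by_contra hne
  have : 0 < ‖s t x - score (σ t) p x‖ := norm_pos_iff.2 (sub_ne_zero.2 hne)
  have : 0 < w t * kernConst D (σ t) *
    (‖s t x - score (σ t) p x‖ ^ 2 * evid (σ t) p x) := by positivity
  linarith

/-- The loss is affine in the data distribution. -/
lemma mixedDsmLoss_eq_dsmLoss_mix {α : ℝ} {τ : Measure ℝ} [SFinite τ] {w σ : ℝ → ℝ}
    (hw : Measurable w) (hσ : Measurable σ) (p q : Measure (Space D)) [SFinite p] [SFinite q]
    {s : ℝ → Space D → Space D} (hs : Measurable (Function.uncurry s)) :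
    mixedDsmLoss α τ w σ p q s = dsmLoss τ w σ (mix α p q) s := by
  have hst : Measurable fun q : ℝ × Space D => s q.1 q.2 := hs
  have hm : ∀ r : Measure (Space D), SFinite r → Measurable fun t => ∫⁻ y, ∫⁻ x,
      ENNReal.ofReal (w t * ‖s t x - condScore (σ t) y x‖ ^ 2) ∂(condLaw (σ t) y) ∂r := by
    intro r _
    have h1 : ∀ t y, ∫⁻ x, ENNReal.ofReal (w t * ‖s t x - condScore (σ t) y x‖ ^ 2)
        ∂(condLaw (σ t) y) = ∫⁻ ε, ENNReal.ofReal (w t * ‖s t (y + σ t • ε) -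
          condScore (σ t) y (y + σ t • ε)‖ ^ 2) ∂(stdGaussian (Space D)) := by
      intro t y
      have hst' : Measurable (s t) := hst.comp measurable_prodMk_left
      rw [condLaw, lintegral_map (by fun_prop) (by fun_prop)]
    simp_rw [h1]
    refine Measurable.lintegral_prod_right' (f := fun a : ℝ × Space D => ∫⁻ ε, ENNReal.ofReal
      (w a.1 * ‖s a.1 (a.2 + σ a.1 • ε) - condScore (σ a.1) a.2 (a.2 + σ a.1 • ε)‖ ^ 2)
        ∂(stdGaussian (Space D))) ?_
    refine Measurable.lintegral_prod_right' (f := fun a : (ℝ × Space D) × Space D =>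
      ENNReal.ofReal (w a.1.1 * ‖s a.1.1 (a.1.2 + σ a.1.1 • a.2) -
        condScore (σ a.1.1) a.1.2 (a.1.2 + σ a.1.1 • a.2)‖ ^ 2)) ?_
    have h2 : Measurable fun a : (ℝ × Space D) × Space D =>
        s a.1.1 (a.1.2 + σ a.1.1 • a.2) :=
      hst.comp (g := fun q : ℝ × Space D => s q.1 q.2)
        (f := fun a : (ℝ × Space D) × Space D => (a.1.1, a.1.2 + σ a.1.1 • a.2)) (by fun_prop)
    fun_prop
  simp only [mixedDsmLoss, dsmLoss, mix, lintegral_add_measure, lintegral_smul_measure,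
    smul_eq_mul]
  rw [lintegral_add_left ((hm p inferInstance).const_mul _),
    lintegral_const_mul _ (hm p inferInstance), lintegral_const_mul _ (hm q inferInstance)]

lemma isArgmin_dsmLoss_mix {α : ℝ} {τ : Measure ℝ} [SFinite τ] {w σ : ℝ → ℝ}
    (hw : Measurable w) (hσ : Measurable σ) {p q : Measure (Space D)} [SFinite p] [SFinite q]
    {s : ℝ → Space D → Space D} (hs : IsArgmin (mixedDsmLoss α τ w σ p q) s) :
    IsArgmin (dsmLoss τ w σ (mix α p q)) s := by
  obtain ⟨h1, h2, h3⟩ := hs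
  refine ⟨h1, ?_, fun s' hs' => ?_⟩
  · rwa [← mixedDsmLoss_eq_dsmLoss_mix hw hσ p q h1]
  · rw [← mixedDsmLoss_eq_dsmLoss_mix hw hσ p q h1, ← mixedDsmLoss_eq_dsmLoss_mix hw hσ p q hs']
    exact h3 s' hs'

/-! ### Convexity of the relative entropy -/

lemma relEnt_self {a : ℝ} (ha : 0 < a) : relEnt a a = 0 := by
  simp [relEnt, div_self ha.ne']

/-- The linear minorant of `relEnt` that touches it along the ray `a = s b`. -/
lemma le_relEnt {a b s : ℝ} (ha : 0 < a) (hb : 0 < b) (hs : 0 < s) :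
    a * Real.log s + b - s * b ≤ relEnt a b := by
  have h := relEnt_nonneg ha (mul_pos hs hb)
  have e : a / (s * b) = a / b / s := by field_simp
  rw [relEnt, e, Real.log_div (by positivity) hs.ne'] at h
  rw [relEnt]
  linarith

lemma relEnt_mix_le {α a b c : ℝ} (hα : α ∈ Set.Ioc (0 : ℝ) 1) (ha : 0 < a) (hb : 0 < b)
    (hc : 0 < c) : relEnt (α * a + (1 - α) * c) (α * b + (1 - α) * c) ≤ α * relEnt a b := by
  have h1 : 0 ≤ 1 - α := by linarith [hα.2]
  have hα0 := hα.1
  set P := α * a + (1 - α) * c with hP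
  set Q := α * b + (1 - α) * c with hQ
  have hP0 : 0 < P := by positivity
  have hQ0 : 0 < Q := by positivity
  have hs : 0 < P / Q := by positivity
  have h2 := mul_le_mul_of_nonneg_left (le_relEnt ha hb hs) hα0.le
  have h3 := mul_le_mul_of_nonneg_left (le_relEnt hc hc hs) h1
  rw [relEnt_self hc] at h3
  have h4 : P / Q * Q = P := by field_simp
  have h5 : relEnt P Q = P * Real.log (P / Q) + Q - P / Q * Q := by rw [relEnt, h4]
  rw [h5]
  have h6 : P * Real.log (P / Q) + Q - P / Q * Q =
    α * (a * Real.log (P / Q) + b - P / Q * b) +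
      (1 - α) * (c * Real.log (P / Q) + c - P / Q * c) := by
    generalize Real.log (P / Q) = l
    generalize P / Q = s
    rw [hP, hQ]; ring
  linarith

/-- Splitting the relative entropy with respect to `c` through an intermediate density `b`. -/
lemma relEnt_eq_add {a b c : ℝ} (ha : 0 < a) (hb : 0 < b) (hc : 0 < c) :
    relEnt a c = relEnt b c + (a - b) * (Real.log b - Real.log c) + relEnt a b := by
  rw [relEnt, relEnt, relEnt, Real.log_div ha.ne' hc.ne', Real.log_div hb.ne' hc.ne',
    Real.log_div ha.ne' hb.ne']
  ring

lemma ofReal_integral_le_lintegral_ofReal {Ω : Type*} [MeasurableSpace Ω] {μ : Measure Ω}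
    {f : Ω → ℝ} (hf : Integrable f μ) :
    ENNReal.ofReal (∫ ω, f ω ∂μ) ≤ ∫⁻ ω, ENNReal.ofReal (f ω) ∂μ := by
  have h := ofReal_integral_eq_lintegral_ofReal hf.pos_part (ae_of_all _ fun _ => le_max_right _ _)
  refine (ENNReal.ofReal_le_ofReal (integral_mono hf hf.pos_part fun _ => le_max_left _ _)).trans
    (h.trans_le (lintegral_mono fun ω => ?_))
  simp [ENNReal.ofReal_max]

variable {Z : Type*} [MeasurableSpace Z]

lemma isProbabilityMeasure_genLaw (pZ : Measure Z) [IsProbabilityMeasure pZ]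
    {X : Z → Space D} (hX : Measurable X) : IsProbabilityMeasure (genLaw pZ X) :=
  Measure.isProbabilityMeasure_map hX.aemeasurable

lemma evid_genLaw {pZ : Measure Z} {X : Z → Space D} (hX : Measurable X) (σ : ℝ) (x : Space D) :
    evid σ (genLaw pZ X) x = ∫ z, kern σ (x - X z) ∂pZ := by
  rw [evid, genLaw, integral_map hX.aemeasurable (Measurable.aestronglyMeasurable (by fun_prop))]

lemma integrable_kern_sub_comp (σ : ℝ) {pZ : Measure Z} [IsFiniteMeasure pZ] {X : Z → Space D}
    (hX : Measurable X) (x : Space D) : Integrable (fun z => kern σ (x - X z)) pZ := by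
  refine Integrable.of_bound (Measurable.aestronglyMeasurable (by fun_prop)) 1
    (ae_of_all _ fun y => ?_)
  rw [Real.norm_of_nonneg (kern_pos _ _).le]
  exact kern_le_one _ _

/-- Joint convexity: the relative entropy of two evidences is at most the average relative entropy
of the kernels under any coupling. -/
lemma ofReal_relEnt_evid_le {σ : ℝ} (hσ : 0 < σ) {pZ : Measure Z} [IsProbabilityMeasure pZ]
    {X Y : Z → Space D} (hX : Measurable X) (hY : Measurable Y) (x : Space D) :
    ENNReal.ofReal
        (kernConst D σ * relEnt (evid σ (genLaw pZ X) x) (evid σ (genLaw pZ Y) x)) ≤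
      ∫⁻ z, ENNReal.ofReal (kernConst D σ * relEnt (kern σ (x - X z)) (kern σ (x - Y z)))
        ∂pZ := by
  have := isProbabilityMeasure_genLaw pZ hX
  have := isProbabilityMeasure_genLaw pZ hY
  have hc := kernConst_pos (D := D) hσ
  have hP := evid_pos σ (genLaw pZ X) x
  have hQ := evid_pos σ (genLaw pZ Y) x
  set P := evid σ (genLaw pZ X) x with hPdef
  set Q := evid σ (genLaw pZ Y) x with hQdef
  have hiX := integrable_kern_sub_comp σ (pZ := pZ) hX x
  have hiY := integrable_kern_sub_comp σ (pZ := pZ) hY x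
  have hi : Integrable (fun z => kernConst D σ * (kern σ (x - X z) * Real.log (P / Q) +
      kern σ (x - Y z) - P / Q * kern σ (x - Y z))) pZ :=
    (((hiX.mul_const _).add hiY).sub (hiY.const_mul _)).const_mul _
  have he : kernConst D σ * relEnt P Q = ∫ z, kernConst D σ * (kern σ (x - X z) *
      Real.log (P / Q) + kern σ (x - Y z) - P / Q * kern σ (x - Y z)) ∂pZ := by
    rw [integral_const_mul, integral_sub (f := fun z => kern σ (x - X z) * Real.log (P / Q) +
      kern σ (x - Y z)) ((hiX.mul_const _).add hiY) (hiY.const_mul _),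
      integral_add (hiX.mul_const _) hiY, integral_mul_const, integral_const_mul,
      ← evid_genLaw hX, ← evid_genLaw hY, ← hPdef, ← hQdef, relEnt,
      div_mul_cancel₀ P hQ.ne']
  rw [he]
  refine (ofReal_integral_le_lintegral_ofReal hi).trans (lintegral_mono fun z => ?_)
  exact ENNReal.ofReal_le_ofReal (mul_le_mul_of_nonneg_left
    (le_relEnt (kern_pos _ _) (kern_pos _ _) (by positivity)) hc.le)

/-! ### Integration against the noised law -/

lemma integrable_withDensity_ofReal_iff {h g : Space D → ℝ} (hh : Measurable h)
    (h0 : ∀ x, 0 ≤ h x) :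
    Integrable g ((vol D).withDensity fun x => ENNReal.ofReal (h x)) ↔
      Integrable (fun x => h x * g x) (vol D) := by
  rw [integrable_withDensity_iff_integrable_smul' (by fun_prop) (by simp)]
  simp only [ENNReal.toReal_ofReal (h0 _), smul_eq_mul]

lemma integral_withDensity_ofReal {h : Space D → ℝ} (g : Space D → ℝ) (hh : Measurable h)
    (h0 : ∀ x, 0 ≤ h x) :
    ∫ x, g x ∂((vol D).withDensity fun x => ENNReal.ofReal (h x)) = ∫ x, h x * g x ∂(vol D) := by
  rw [integral_withDensity_eq_integral_toReal_smul (by fun_prop) (by simp)]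
  simp only [ENNReal.toReal_ofReal (h0 _), smul_eq_mul]

lemma noisedLaw_genLaw (σ : ℝ) {pZ : Measure Z} [SFinite pZ] {X : Z → Space D}
    (hX : Measurable X) : noisedLaw σ (genLaw pZ X) =
      (pZ.prod (stdGaussian (Space D))).map fun y => X y.1 + σ • y.2 := by
  have h := Measure.map_prod_map pZ (stdGaussian (Space D)) hX measurable_id
  rw [Measure.map_id] at h
  rw [noisedLaw, genLaw, h, Measure.map_map (by fun_prop) (by fun_prop)]
  rfl

lemma integrable_evid_mul {σ : ℝ} (hσ : 0 < σ) {pZ : Measure Z} [IsProbabilityMeasure pZ]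
    {X : Z → Space D} (hX : Measurable X) {g : Space D → ℝ} (hg : Measurable g)
    (h : Integrable (fun y : Z × Space D => g (X y.1 + σ • y.2))
      (pZ.prod (stdGaussian (Space D)))) :
    Integrable (fun x => kernConst D σ * evid σ (genLaw pZ X) x * g x) (vol D) := by
  have := isProbabilityMeasure_genLaw pZ hX
  rw [← integrable_withDensity_ofReal_iff (by fun_prop)
    (fun x => mul_nonneg (kernConst_pos hσ).le (evid_pos _ _ _).le), ← noisedLaw_eq_withDensity hσ,
    noisedLaw_genLaw σ hX, integrable_map_measure hg.aestronglyMeasurable (by fun_prop)]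
  exact h

lemma integral_evid_mul {σ : ℝ} (hσ : 0 < σ) {pZ : Measure Z} [IsProbabilityMeasure pZ]
    {X : Z → Space D} (hX : Measurable X) {g : Space D → ℝ} (hg : Measurable g) :
    ∫ x, kernConst D σ * evid σ (genLaw pZ X) x * g x ∂(vol D) =
      ∫ y : Z × Space D, g (X y.1 + σ • y.2) ∂(pZ.prod (stdGaussian (Space D))) := by
  have := isProbabilityMeasure_genLaw pZ hX
  rw [← integral_withDensity_ofReal g (h := fun x => kernConst D σ * evid σ (genLaw pZ X) x)
    (by fun_prop)
    (fun x => mul_nonneg (kernConst_pos hσ).le (evid_pos _ _ _).le), ← noisedLaw_eq_withDensity hσ,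
    noisedLaw_genLaw σ hX, integral_map (by fun_prop) hg.aestronglyMeasurable]

lemma memLp_two_stdGaussian : MemLp (fun x : Space D => x) 2 (stdGaussian (Space D)) :=
  IsGaussian.memLp_two_id

lemma memLp_two_add_smul (σ : ℝ) {pZ : Measure Z} [IsProbabilityMeasure pZ] {X : Z → Space D}
    (hX2 : MemLp X 2 pZ) :
    MemLp (fun y : Z × Space D => X y.1 + σ • y.2) 2 (pZ.prod (stdGaussian (Space D))) :=
  (hX2.comp_fst _).add ((memLp_two_stdGaussian.comp_snd _).const_smul σ)

lemma integrable_norm_add_const_sq {Ω : Type*} [MeasurableSpace Ω] {μ : Measure Ω}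
    [IsFiniteMeasure μ] {U : Ω → Space D} (hU : MemLp U 2 μ) (R : ℝ) :
    Integrable (fun ω => (‖U ω‖ + R) ^ 2) μ :=
  (hU.norm.add (memLp_const R)).integrable_sq

/-! ### Gaussian relative entropy -/

/-- The relative entropy of `𝓝(a, σ² I)` with respect to `𝓝(b, σ² I)`. -/
lemma lintegral_relEnt_kern {σ : ℝ} (hσ : 0 < σ) (a b : Space D) :
    ∫⁻ x, ENNReal.ofReal (kernConst D σ * relEnt (kern σ (x - a)) (kern σ (x - b))) ∂(vol D) =
      ENNReal.ofReal ((2 * σ ^ 2)⁻¹ * ‖a - b‖ ^ 2) := by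
  have hc := kernConst_pos (D := D) hσ
  have hk0 : ∀ c x : Space D, 0 ≤ kernConst D σ * kern σ (x - c) := fun c x =>
    mul_nonneg hc.le (kern_pos _ _).le
  have hki : ∀ c : Space D, Integrable (fun x => kernConst D σ * kern σ (x - c)) (vol D) :=
    fun c => ((integrable_kern hσ).comp_sub_right c).const_mul _
  have hk1 : ∀ c : Space D, ∫ x, kernConst D σ * kern σ (x - c) ∂(vol D) = 1 := fun c => by
    rw [integral_eq_lintegral_of_nonneg_ae (ae_of_all _ (hk0 c)) (hki c).1,
      lintegral_kern_sub hσ, ENNReal.toReal_one]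
  set g : Space D → ℝ := fun x => inner ℝ (x - a) (a - b) with hg
  have hgm : Measurable g := by rw [hg]; fun_prop
  have hge : ∀ ε : Space D, g (a + σ • ε) = σ * innerSL ℝ (a - b) ε := fun ε => by
    rw [innerSL_apply_apply, real_inner_comm ε (a - b)]
    simp only [hg, add_sub_cancel_left, inner_smul_left, conj_trivial]
  have hLi : Integrable (fun ε => innerSL ℝ (a - b) ε) (stdGaussian (Space D)) :=
    (innerSL ℝ (a - b)).integrable_comp
      (memLp_two_stdGaussian.integrable (by norm_num))
  have hgi : Integrable (fun x => kernConst D σ * kern σ (x - a) * g x) (vol D) := by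
    rw [← integrable_withDensity_ofReal_iff (by fun_prop) (hk0 a), ← condLaw_eq_withDensity hσ,
      condLaw, integrable_map_measure hgm.aestronglyMeasurable (by fun_prop)]
    simp only [Function.comp_def, hge]
    exact hLi.const_mul σ
  have hg0 : ∫ x, kernConst D σ * kern σ (x - a) * g x ∂(vol D) = 0 := by
    rw [← integral_withDensity_ofReal g (h := fun x => kernConst D σ * kern σ (x - a))
      (by fun_prop) (hk0 a), ← condLaw_eq_withDensity hσ,
      condLaw, integral_map (by fun_prop) hgm.aestronglyMeasurable]
    simp only [hge]
    rw [integral_const_mul, integral_strongDual_stdGaussian, mul_zero]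
  have he : ∀ x, kernConst D σ * relEnt (kern σ (x - a)) (kern σ (x - b)) =
      ((2 * σ ^ 2)⁻¹ * 2) * (kernConst D σ * kern σ (x - a) * g x) +
        ((2 * σ ^ 2)⁻¹ * ‖a - b‖ ^ 2) * (kernConst D σ * kern σ (x - a)) +
        (kernConst D σ * kern σ (x - b) - kernConst D σ * kern σ (x - a)) := by
    intro x
    have e : x - b = (x - a) + (a - b) := by abel
    have e2 : ‖x - b‖ ^ 2 = ‖x - a‖ ^ 2 + 2 * g x + ‖a - b‖ ^ 2 := by
      rw [e, norm_add_sq_real]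
    rw [relEnt, Real.log_div (kern_pos _ _).ne' (kern_pos _ _).ne', log_kern, log_kern, e2]
    ring
  rw [← ofReal_integral_eq_lintegral_ofReal]
  · congr 1
    simp_rw [he]
    rw [integral_add (f := fun x => ((2 * σ ^ 2)⁻¹ * 2) * (kernConst D σ * kern σ (x - a) * g x) +
        ((2 * σ ^ 2)⁻¹ * ‖a - b‖ ^ 2) * (kernConst D σ * kern σ (x - a)))
      ((hgi.const_mul _).add ((hki a).const_mul _))
      (g := fun x => kernConst D σ * kern σ (x - b) - kernConst D σ * kern σ (x - a))
      ((hki b).sub (hki a)),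
      integral_add (hgi.const_mul _) ((hki a).const_mul _), integral_sub (hki b) (hki a),
      integral_const_mul ((2 * σ ^ 2)⁻¹ * 2),
      integral_const_mul ((2 * σ ^ 2)⁻¹ * ‖a - b‖ ^ 2), hg0, hk1, hk1]
    ring
  · simp_rw [he]
    exact ((hgi.const_mul _).add ((hki a).const_mul _)).add ((hki b).sub (hki a))
  · exact ae_of_all _ fun x => mul_nonneg hc.le (relEnt_nonneg (kern_pos _ _) (kern_pos _ _))

/-- The relative entropy between two noised laws is controlled by the transport cost of any
coupling of the clean laws. -/
lemma lintegral_relEnt_evid_genLaw_le {σ : ℝ} (hσ : 0 < σ) {pZ : Measure Z}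
    [IsProbabilityMeasure pZ] {X Y : Z → Space D} (hX : Measurable X) (hY : Measurable Y)
    (hX2 : MemLp X 2 pZ) (hY2 : MemLp Y 2 pZ) :
    ∫⁻ x, ENNReal.ofReal
        (kernConst D σ * relEnt (evid σ (genLaw pZ X) x) (evid σ (genLaw pZ Y) x)) ∂(vol D) ≤
      ENNReal.ofReal ((2 * σ ^ 2)⁻¹ * ∫ z, ‖X z - Y z‖ ^ 2 ∂pZ) := by
  refine (lintegral_mono fun x => ofReal_relEnt_evid_le hσ hX hY x).trans ?_
  rw [lintegral_lintegral_swap (by fun_prop)]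
  simp_rw [lintegral_relEnt_kern hσ]
  rw [← integral_const_mul, ofReal_integral_eq_lintegral_ofReal]
  · exact ((hX2.sub hY2).integrable_norm_pow (p := 2) (by norm_num)).const_mul _
  · exact ae_of_all _ fun z => by positivity

/-! ### Finiteness and first-order expansion of the mixed divergence -/

/-- The mixed divergence of square-integrable generated data is finite, with an explicit dependence
on the noise level, whatever the tails of the real data. -/
lemma exists_mixedKL_le {α : ℝ} (hα : α ∈ Set.Ioc (0 : ℝ) 1) {pZ : Measure Z}
    [IsProbabilityMeasure pZ] {X : Z → Space D} (hX : Measurable X) (hX2 : MemLp X 2 pZ)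
    (q : Measure (Space D)) [IsProbabilityMeasure q] :
    ∃ C : ℝ, ∀ σ : ℝ, 0 < σ →
      mixedKL α σ (genLaw pZ X) q ≤ ENNReal.ofReal (C * (1 + (σ ^ 2)⁻¹)) := by
  have := isProbabilityMeasure_genLaw pZ hX
  obtain ⟨R, hR, hqR⟩ := exists_half_le_measureReal_closedBall q
  set M := ∫ z, ‖X z‖ ^ 2 ∂pZ with hM
  set E := ∫ ε, ‖ε‖ ^ 2 ∂(stdGaussian (Space D)) with hE
  have hM0 : 0 ≤ M := integral_nonneg fun _ => by positivity
  have hE0 : 0 ≤ E := integral_nonneg fun _ => by positivity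
  refine ⟨2 + 3 * M + 3 * E + 3 * R ^ 2, fun σ hσ => ?_⟩
  have hc := kernConst_pos (D := D) hσ
  set g : Space D → ℝ := fun x => Real.log 2 + (2 * σ ^ 2)⁻¹ * (‖x‖ + R) ^ 2 with hg
  have hlog2 : 0 ≤ Real.log 2 := Real.log_nonneg (by norm_num)
  have hg0 : ∀ x, 0 ≤ g x := fun x => by positivity
  have hgm : Measurable g := by rw [hg]; fun_prop
  have hU := integrable_norm_add_const_sq (memLp_two_add_smul σ hX2) R
  have hgi : Integrable (fun y : Z × Space D => g (X y.1 + σ • y.2))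
      (pZ.prod (stdGaussian (Space D))) := (integrable_const _).add (hU.const_mul _)
  have hone : ∫⁻ x, ENNReal.ofReal (kernConst D σ * evid σ q x) ∂(vol D) = 1 := by
    rw [← setLIntegral_univ, ← withDensity_apply _ .univ, ← noisedLaw_eq_withDensity hσ,
      measure_univ]
  -- convexity discards the real part of the mixture, whose second moment may be infinite
  have hpt : ∀ x, relEnt (evid σ (mix α (genLaw pZ X) q) x) (evid σ q x) ≤
      evid σ (genLaw pZ X) x * g x + evid σ q x := by
    intro x
    have hP := evid_pos σ (genLaw pZ X) x
    have hQ := evid_pos σ q x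
    have h1 := relEnt_mix_le hα hP hQ hQ
    rw [← evid_mix hα, ← add_mul, add_sub_cancel, one_mul] at h1
    have h2 : relEnt (evid σ (genLaw pZ X) x) (evid σ q x) ≤
        evid σ (genLaw pZ X) x * g x + evid σ q x := by
      rw [relEnt, Real.log_div hP.ne' hQ.ne']
      have h3 := neg_log_evid_le (σ := σ) hqR x
      have h4 := log_evid_nonpos σ (genLaw pZ X) x
      have h5 : Real.log (evid σ (genLaw pZ X) x) - Real.log (evid σ q x) ≤ g x := by
        rw [hg]; linarith
      have h6 := mul_le_mul_of_nonneg_left h5 hP.le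
      linarith
    have h3 := relEnt_nonneg hP hQ
    nlinarith [hα.2]
  have hsq : ∫ y : Z × Space D, (‖X y.1 + σ • y.2‖ + R) ^ 2 ∂(pZ.prod (stdGaussian (Space D))) ≤
      3 * M + 3 * σ ^ 2 * E + 3 * R ^ 2 := by
    have i1 : Integrable (fun y : Z × Space D => 3 * ‖X y.1‖ ^ 2)
        (pZ.prod (stdGaussian (Space D))) :=
      ((hX2.integrable_norm_pow (p := 2) (by norm_num)).comp_fst _).const_mul 3
    have i2 : Integrable (fun y : Z × Space D => 3 * σ ^ 2 * ‖y.2‖ ^ 2)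
        (pZ.prod (stdGaussian (Space D))) :=
      ((memLp_two_stdGaussian.integrable_norm_pow (p := 2) (by norm_num)).comp_snd _).const_mul _
    have i12 : Integrable (fun y : Z × Space D => 3 * ‖X y.1‖ ^ 2 + 3 * σ ^ 2 * ‖y.2‖ ^ 2)
        (pZ.prod (stdGaussian (Space D))) := i1.add i2
    have e1 : ∫ y : Z × Space D, ‖X y.1‖ ^ 2 ∂(pZ.prod (stdGaussian (Space D))) = M := by
      rw [integral_fun_fst (fun z => ‖X z‖ ^ 2)]; simp [hM]
    have e2 : ∫ y : Z × Space D, ‖y.2‖ ^ 2 ∂(pZ.prod (stdGaussian (Space D))) = E := by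
      rw [integral_fun_snd (fun z : Space D => ‖z‖ ^ 2)]; simp [hE]
    refine (integral_mono hU (i12.add (integrable_const (3 * R ^ 2))) fun y => ?_).trans_eq ?_
    · have h := norm_add_le (X y.1) (σ • y.2)
      rw [norm_smul, Real.norm_of_nonneg hσ.le] at h
      calc (‖X y.1 + σ • y.2‖ + R) ^ 2 ≤ (‖X y.1‖ + σ * ‖y.2‖ + R) ^ 2 := by gcongr
        _ ≤ 3 * ‖X y.1‖ ^ 2 + 3 * σ ^ 2 * ‖y.2‖ ^ 2 + 3 * R ^ 2 := by
          nlinarith [sq_nonneg (‖X y.1‖ - σ * ‖y.2‖), sq_nonneg (‖X y.1‖ - R),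
            sq_nonneg (σ * ‖y.2‖ - R)]
    · rw [integral_add' i12 (integrable_const _), integral_add i1 i2, integral_const_mul,
        integral_const_mul, e1, e2]
      simp
  have hgint : ∫ y : Z × Space D, g (X y.1 + σ • y.2) ∂(pZ.prod (stdGaussian (Space D))) ≤
      Real.log 2 + (2 * σ ^ 2)⁻¹ * (3 * M + 3 * σ ^ 2 * E + 3 * R ^ 2) := by
    rw [hg, integral_add (integrable_const _) (hU.const_mul _), integral_const_mul]
    simp only [integral_const, probReal_univ, one_smul]
    gcongr
  rw [mixedKL_eq_lintegral hα hσ]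
  calc ∫⁻ x, ENNReal.ofReal (kernConst D σ *
        relEnt (evid σ (mix α (genLaw pZ X) q) x) (evid σ q x)) ∂(vol D)
      ≤ ∫⁻ x, (ENNReal.ofReal (kernConst D σ * evid σ (genLaw pZ X) x * g x) +
          ENNReal.ofReal (kernConst D σ * evid σ q x)) ∂(vol D) := by
        refine lintegral_mono fun x => ?_
        rw [← ENNReal.ofReal_add (mul_nonneg (mul_nonneg hc.le (evid_pos _ _ _).le) (hg0 x))
          (mul_nonneg hc.le (evid_pos _ _ _).le)]
        refine ENNReal.ofReal_le_ofReal ?_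
        rw [mul_assoc, ← mul_add]
        exact mul_le_mul_of_nonneg_left (hpt x) hc.le
    _ = ENNReal.ofReal
          (∫ y : Z × Space D, g (X y.1 + σ • y.2) ∂(pZ.prod (stdGaussian (Space D)))) + 1 := by
        rw [lintegral_add_left (by fun_prop), hone, ← integral_evid_mul hσ hX hgm,
          ofReal_integral_eq_lintegral_ofReal (integrable_evid_mul hσ hX hgm hgi)
          (ae_of_all _ fun x => mul_nonneg (mul_nonneg hc.le (evid_pos _ _ _).le) (hg0 x))]
    _ ≤ ENNReal.ofReal ((2 + 3 * M + 3 * E + 3 * R ^ 2) * (1 + (σ ^ 2)⁻¹)) := by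
        rw [← ENNReal.ofReal_one, ← ENNReal.ofReal_add (integral_nonneg fun y => hg0 _) zero_le_one]
        refine ENNReal.ofReal_le_ofReal ((add_le_add_left hgint 1).trans ?_)
        have h2 : Real.log 2 ≤ 1 := by linarith [Real.log_two_lt_d9]
        have e : (2 * σ ^ 2)⁻¹ * (3 * M + 3 * σ ^ 2 * E + 3 * R ^ 2) =
          (σ ^ 2)⁻¹ * (3 * M + 3 * R ^ 2) / 2 + 3 * E / 2 := by field_simp; ring
        have h3 : 0 ≤ (σ ^ 2)⁻¹ := by positivity
        rw [e]
        nlinarith [mul_nonneg h3 hM0, mul_nonneg h3 hE0, mul_nonneg h3 (sq_nonneg R), sq_nonneg R]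

lemma mixedKL_ne_top {α : ℝ} (hα : α ∈ Set.Ioc (0 : ℝ) 1) {σ : ℝ} (hσ : 0 < σ) {pZ : Measure Z}
    [IsProbabilityMeasure pZ] {X : Z → Space D} (hX : Measurable X) (hX2 : MemLp X 2 pZ)
    (q : Measure (Space D)) [IsProbabilityMeasure q] : mixedKL α σ (genLaw pZ X) q ≠ ∞ := by
  obtain ⟨C, hC⟩ := exists_mixedKL_le hα hX hX2 q
  exact ne_top_of_le_ne_top ENNReal.ofReal_ne_top (hC σ hσ)

lemma integrable_logRatio_comp {σ : ℝ} {pZ : Measure Z} [IsProbabilityMeasure pZ]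
    {X : Z → Space D} (hX : Measurable X) (hX2 : MemLp X 2 pZ) (p q : Measure (Space D))
    [IsProbabilityMeasure p] [IsProbabilityMeasure q] :
    Integrable (fun y : Z × Space D => logRatio σ p q (X y.1 + σ • y.2))
      (pZ.prod (stdGaussian (Space D))) := by
  obtain ⟨R₁, hR₁, hp⟩ := exists_half_le_measureReal_closedBall p
  obtain ⟨R₂, hR₂, hq⟩ := exists_half_le_measureReal_closedBall q
  have hp' := hp.trans (measureReal_mono (μ := p)
    (Metric.closedBall_subset_closedBall (le_max_left R₁ R₂)))
  have hq' := hq.trans (measureReal_mono (μ := q)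
    (Metric.closedBall_subset_closedBall (le_max_right R₁ R₂)))
  refine Integrable.mono' ((integrable_const (Real.log 2)).add
    ((integrable_norm_add_const_sq (memLp_two_add_smul σ hX2) (max R₁ R₂)).const_mul
      (2 * σ ^ 2)⁻¹)) (Measurable.aestronglyMeasurable (by fun_prop)) (ae_of_all _ fun y => ?_)
  exact abs_logRatio_le hp' hq' _

/-- First-order expansion of the mixed divergence around `Y`. The linear term is the change of the
log-likelihood ratio at `Y`; the error is the relative entropy between the two mixtures, which is
quadratic in the transport cost. -/
lemma abs_mixedKL_sub_sub_le {α : ℝ} (hα : α ∈ Set.Ioc (0 : ℝ) 1) {σ : ℝ} (hσ : 0 < σ)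
    {pZ : Measure Z} [IsProbabilityMeasure pZ] {X Y : Z → Space D} (hX : Measurable X)
    (hY : Measurable Y) (hX2 : MemLp X 2 pZ) (hY2 : MemLp Y 2 pZ) (q : Measure (Space D))
    [IsProbabilityMeasure q] :
    |(mixedKL α σ (genLaw pZ X) q).toReal - (mixedKL α σ (genLaw pZ Y) q).toReal -
        ∫ y : Z × Space D, α * (logRatio σ (mix α (genLaw pZ Y) q) q (X y.1 + σ • y.2) -
          logRatio σ (mix α (genLaw pZ Y) q) q (Y y.1 + σ • y.2))
          ∂(pZ.prod (stdGaussian (Space D)))| ≤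
      (2 * σ ^ 2)⁻¹ * ∫ z, ‖X z - Y z‖ ^ 2 ∂pZ := by
  have := isProbabilityMeasure_genLaw pZ hX
  have := isProbabilityMeasure_genLaw pZ hY
  have := isProbabilityMeasure_mix hα (genLaw pZ X) q
  have := isProbabilityMeasure_mix hα (genLaw pZ Y) q
  have hc := kernConst_pos (D := D) hσ
  set u := evid σ (mix α (genLaw pZ X) q) with hu
  set v := evid σ (mix α (genLaw pZ Y) q) with hv
  set l := logRatio σ (mix α (genLaw pZ Y) q) q with hl
  have hu0 : ∀ x, 0 < u x := evid_pos _ _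
  have hv0 : ∀ x, 0 < v x := evid_pos _ _
  have hq0 : ∀ x, 0 < evid σ q x := evid_pos _ _
  have hum : Measurable u := by rw [hu]; fun_prop
  have hvm : Measurable v := by rw [hv]; fun_prop
  have hlm : Measurable l := by rw [hl]; fun_prop
  have hint : ∀ a b : Space D → ℝ, Measurable a → Measurable b → (∀ x, 0 < a x) → (∀ x, 0 < b x) →
      ∫⁻ x, ENNReal.ofReal (kernConst D σ * relEnt (a x) (b x)) ∂(vol D) ≠ ∞ →
      Integrable (fun x => kernConst D σ * relEnt (a x) (b x)) (vol D) ∧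
      ∫ x, kernConst D σ * relEnt (a x) (b x) ∂(vol D) =
        (∫⁻ x, ENNReal.ofReal (kernConst D σ * relEnt (a x) (b x)) ∂(vol D)).toReal := by
    intro a b ha hb ha0 hb0 hfin
    have h0 : 0 ≤ᵐ[vol D] fun x => kernConst D σ * relEnt (a x) (b x) :=
      ae_of_all _ fun x => mul_nonneg hc.le (relEnt_nonneg (ha0 x) (hb0 x))
    have hm : AEStronglyMeasurable (fun x => kernConst D σ * relEnt (a x) (b x)) (vol D) :=
      Measurable.aestronglyMeasurable (by fun_prop)
    exact ⟨(lintegral_ofReal_ne_top_iff_integrable hm h0).1 hfin,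
      integral_eq_lintegral_of_nonneg_ae h0 hm⟩
  have hKX := mixedKL_ne_top hα hσ hX hX2 q
  have hKY := mixedKL_ne_top hα hσ hY hY2 q
  rw [mixedKL_eq_lintegral hα hσ] at hKX hKY ⊢
  rw [mixedKL_eq_lintegral hα hσ]
  obtain ⟨iX, eX⟩ := hint u (evid σ q) hum (by fun_prop) hu0 hq0 hKX
  obtain ⟨iY, eY⟩ := hint v (evid σ q) hvm (by fun_prop) hv0 hq0 hKY
  have huv : ∫⁻ x, ENNReal.ofReal (kernConst D σ * relEnt (u x) (v x)) ∂(vol D) ≤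
      ENNReal.ofReal ((2 * σ ^ 2)⁻¹ * ∫ z, ‖X z - Y z‖ ^ 2 ∂pZ) := by
    refine (lintegral_mono fun x => ENNReal.ofReal_le_ofReal ?_).trans
      (lintegral_relEnt_evid_genLaw_le hσ hX hY hX2 hY2)
    refine mul_le_mul_of_nonneg_left ?_ hc.le
    have h1 := relEnt_mix_le hα (evid_pos σ (genLaw pZ X) x) (evid_pos σ (genLaw pZ Y) x) (hq0 x)
    have h2 := relEnt_nonneg (evid_pos σ (genLaw pZ X) x) (evid_pos σ (genLaw pZ Y) x)
    rw [hu, hv, evid_mix hα, evid_mix hα]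
    nlinarith [hα.2]
  obtain ⟨-, eR⟩ := hint u v hum hvm hu0 hv0 (ne_top_of_le_ne_top ENNReal.ofReal_ne_top huv)
  have hRle : ∫ x, kernConst D σ * relEnt (u x) (v x) ∂(vol D) ≤
      (2 * σ ^ 2)⁻¹ * ∫ z, ‖X z - Y z‖ ^ 2 ∂pZ := by
    rw [eR]
    exact ENNReal.toReal_le_of_le_ofReal
      (mul_nonneg (by positivity) (integral_nonneg fun _ => by positivity)) huv
  have hR0 : 0 ≤ ∫ x, kernConst D σ * relEnt (u x) (v x) ∂(vol D) :=
    integral_nonneg fun x => mul_nonneg hc.le (relEnt_nonneg (hu0 x) (hv0 x))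
  have jX := integrable_logRatio_comp (σ := σ) hX hX2 (mix α (genLaw pZ Y) q) q
  have jY := integrable_logRatio_comp (σ := σ) hY hY2 (mix α (genLaw pZ Y) q) q
  have kX := integrable_evid_mul hσ hX hlm jX
  have kY := integrable_evid_mul hσ hY hlm jY
  have hlin : ∫ y : Z × Space D, α * (l (X y.1 + σ • y.2) - l (Y y.1 + σ • y.2))
        ∂(pZ.prod (stdGaussian (Space D))) =
      ∫ x, α * (kernConst D σ * evid σ (genLaw pZ X) x * l x -
        kernConst D σ * evid σ (genLaw pZ Y) x * l x) ∂(vol D) := by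
    rw [integral_const_mul, integral_const_mul, integral_sub jX jY, integral_sub kX kY,
      integral_evid_mul hσ hX hlm, integral_evid_mul hσ hY hlm]
  -- `relEnt (u, q) - relEnt (v, q) - (u - v) log (v / q) = relEnt (u, v)`, and the real data
  -- cancel in `u - v`
  have hpt : ∀ x, kernConst D σ * relEnt (u x) (v x) =
      (kernConst D σ * relEnt (u x) (evid σ q x) - kernConst D σ * relEnt (v x) (evid σ q x)) -
        α * (kernConst D σ * evid σ (genLaw pZ X) x * l x -
          kernConst D σ * evid σ (genLaw pZ Y) x * l x) := by
    intro x
    rw [relEnt_eq_add (hu0 x) (hv0 x) (hq0 x)]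
    have e : u x - v x = α * (evid σ (genLaw pZ X) x - evid σ (genLaw pZ Y) x) := by
      rw [hu, hv, evid_mix hα, evid_mix hα]; ring
    rw [e]
    change _ = (_ - _) - α * (_ * _ * (Real.log (v x) - Real.log (evid σ q x)) - _)
    change _ = (_ - _) - α * (_ - _ * _ * (Real.log (v x) - Real.log (evid σ q x)))
    ring
  have hmain : ∫ x, kernConst D σ * relEnt (u x) (v x) ∂(vol D) =
      ∫ x, kernConst D σ * relEnt (u x) (evid σ q x) ∂(vol D) -
        ∫ x, kernConst D σ * relEnt (v x) (evid σ q x) ∂(vol D) -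
        ∫ y : Z × Space D, α * (l (X y.1 + σ • y.2) - l (Y y.1 + σ • y.2))
          ∂(pZ.prod (stdGaussian (Space D))) := by
    rw [hlin, integral_congr_ae (ae_of_all _ hpt), integral_sub
      (f := fun x => kernConst D σ * relEnt (u x) (evid σ q x) -
        kernConst D σ * relEnt (v x) (evid σ q x)) (iX.sub iY)
      (g := fun x => α * (kernConst D σ * evid σ (genLaw pZ X) x * l x -
        kernConst D σ * evid σ (genLaw pZ Y) x * l x)) ((kX.sub kY).const_mul α),
      integral_sub iX iY]
  rw [← eX, ← eY, ← hmain, abs_of_nonneg hR0]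
  exact hRle

variable {m : ℕ}

/-! ### Differentiation of the averaged divergence -/

lemma memLp_two_of_norm_sub_le {pZ : Measure Z} {X Y : Z → Space D} (hX : Measurable X)
    (hY : Measurable Y) (hY2 : MemLp Y 2 pZ) {K : Z → ℝ} (hK : MemLp K 2 pZ) {δ : ℝ}
    (h : ∀ᵐ z ∂pZ, ‖X z - Y z‖ ≤ K z * δ) : MemLp X 2 pZ := by
  have h1 : MemLp (X - Y) 2 pZ :=
    (hK.mul_const δ).mono (hX.sub hY).aestronglyMeasurable
      (h.mono fun z hz => hz.trans (Real.le_norm_self _))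
  simpa using h1.add hY2

/-- Directional derivatives at a point of differentiability are limits of difference quotients, so
they are measurable in the latent variable although `G` is measurable only for each parameter. -/
lemma aemeasurable_fderiv_apply {pZ : Measure Z} {G : EuclideanSpace ℝ (Fin m) → Z → Space D}
    (hG : ∀ θ, Measurable (G θ)) {θ₀ : EuclideanSpace ℝ (Fin m)}
    (hG_diff : ∀ᵐ z ∂pZ, DifferentiableAt ℝ (fun θ => G θ z) θ₀) (u : EuclideanSpace ℝ (Fin m)) :
    AEMeasurable (fun z => fderiv ℝ (fun θ => G θ z) θ₀ u) pZ := by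
  refine aemeasurable_of_tendsto_metrizable_ae atTop
    (f := fun (n : ℕ) z => (n : ℝ) • (G (θ₀ + (n : ℝ)⁻¹ • u) z - G θ₀ z))
    (fun n => Measurable.aemeasurable (((hG _).sub (hG θ₀)).const_smul (n : ℝ))) ?_
  filter_upwards [hG_diff] with z hz
  refine hz.hasFDerivAt.lim u ?_
  simpa using tendsto_natCast_atTop_atTop (R := ℝ)

lemma aestronglyMeasurable_gradSample {τ : Measure ℝ} [SFinite τ] {σ : ℝ → ℝ} (hσ : Measurable σ)
    {pZ : Measure Z} [SFinite pZ] {G : EuclideanSpace ℝ (Fin m) → Z → Space D}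
    (hG : ∀ θ, Measurable (G θ)) {θ₀ : EuclideanSpace ℝ (Fin m)}
    (hG_diff : ∀ᵐ z ∂pZ, DifferentiableAt ℝ (fun θ => G θ z) θ₀) (α : ℝ)
    {s₁ s₂ : ℝ → Space D → Space D} (hs₁ : Measurable (Function.uncurry s₁))
    (hs₂ : Measurable (Function.uncurry s₂)) :
    AEStronglyMeasurable (fun y : ℝ × Z × Space D => gradSample α σ G s₁ s₂ θ₀ y.1 y.2.1 y.2.2)
      (τ.prod (pZ.prod (stdGaussian (Space D)))) := by
  have hs : ∀ s : ℝ → Space D → Space D, Measurable (Function.uncurry s) →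
      Measurable fun y : ℝ × Z × Space D => s y.1 (G θ₀ y.2.1 + σ y.1 • y.2.2) := by
    intro s hs
    have := hG θ₀
    exact hs.comp (f := fun y : ℝ × Z × Space D => (y.1, G θ₀ y.2.1 + σ y.1 • y.2.2))
      (by fun_prop)
  have hc : Measurable fun y : ℝ × Z × Space D =>
      α • (s₁ y.1 (G θ₀ y.2.1 + σ y.1 • y.2.2) - s₂ y.1 (G θ₀ y.2.1 + σ y.1 • y.2.2)) :=
    ((hs s₁ hs₁).sub (hs s₂ hs₂)).const_smul α
  have hq : Measure.QuasiMeasurePreserving (fun y : ℝ × Z × Space D => y.2.1)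
      (τ.prod (pZ.prod (stdGaussian (Space D)))) pZ :=
    Measure.quasiMeasurePreserving_fst.comp Measure.quasiMeasurePreserving_snd
  have hJ : ∀ i, AEMeasurable (fun y : ℝ × Z × Space D =>
      fderiv ℝ (fun θ => G θ y.2.1) θ₀ (EuclideanSpace.basisFun (Fin m) ℝ i))
      (τ.prod (pZ.prod (stdGaussian (Space D)))) := fun i =>
    (aemeasurable_fderiv_apply hG hG_diff _).comp_quasiMeasurePreserving hq
  have he : (fun y : ℝ × Z × Space D => gradSample α σ G s₁ s₂ θ₀ y.1 y.2.1 y.2.2) =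
      fun y => ∑ i, (inner ℝ (fderiv ℝ (fun θ => G θ y.2.1) θ₀
        (EuclideanSpace.basisFun (Fin m) ℝ i))
        (α • (s₁ y.1 (G θ₀ y.2.1 + σ y.1 • y.2.2) - s₂ y.1 (G θ₀ y.2.1 + σ y.1 • y.2.2)))) •
        EuclideanSpace.basisFun (Fin m) ℝ i := by
    ext1 y
    rw [← (EuclideanSpace.basisFun (Fin m) ℝ).sum_repr'
      (gradSample α σ G s₁ s₂ θ₀ y.1 y.2.1 y.2.2)]
    refine Finset.sum_congr rfl fun i _ => ?_
    rw [gradSample, ContinuousLinearMap.adjoint_inner_right]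
  rw [he]
  refine AEMeasurable.aestronglyMeasurable (Finset.aemeasurable_fun_sum _ fun i _ => ?_)
  exact ((hJ i).inner hc.aemeasurable).smul_const _

lemma aemeasurable_mixedKL {τ : Measure ℝ} [SFinite τ] {σ : ℝ → ℝ} (hσ : Measurable σ)
    (hσ_pos : ∀ᵐ t ∂τ, 0 < σ t) {α : ℝ} (hα : α ∈ Set.Ioc (0 : ℝ) 1) (p q : Measure (Space D))
    [IsProbabilityMeasure p] [IsProbabilityMeasure q] :
    AEMeasurable (fun t => (mixedKL α (σ t) p q).toReal) τ := by
  have := isProbabilityMeasure_mix hα p q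
  refine AEMeasurable.ennreal_toReal ⟨fun t => ∫⁻ x, ENNReal.ofReal (kernConst D (σ t) *
    relEnt (evid (σ t) (mix α p q) x) (evid (σ t) q x)) ∂(vol D), ?_, ?_⟩
  · exact Measurable.lintegral_prod_right' (f := fun y : ℝ × Space D => ENNReal.ofReal
      (kernConst D (σ y.1) * relEnt (evid (σ y.1) (mix α p q) y.2) (evid (σ y.1) q y.2)))
      (by fun_prop)
  · filter_upwards [hσ_pos] with t ht
    exact mixedKL_eq_lintegral hα ht p q

/-- The averaged divergence is differentiable when `E_t [σ_t⁻²] < ∞`, with the pathwise gradient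
formula for the exact scores. The linear term of the expansion is differentiated under the
expectation; the error term is `O(‖θ - θ₀‖²)`. -/
lemma hasGradientAt_integral_mixedKL {τ : Measure ℝ} [IsProbabilityMeasure τ] {σ : ℝ → ℝ}
    (hσ : Measurable σ) (hσ_pos : ∀ᵐ t ∂τ, 0 < σ t) (hσ_int : Integrable (fun t => (σ t ^ 2)⁻¹) τ)
    (q : Measure (Space D)) [IsProbabilityMeasure q] {pZ : Measure Z} [IsProbabilityMeasure pZ]
    {G : EuclideanSpace ℝ (Fin m) → Z → Space D} (hG : ∀ θ, Measurable (G θ))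
    {θ₀ : EuclideanSpace ℝ (Fin m)} (hG_sq : MemLp (G θ₀) 2 pZ)
    (hG_diff : ∀ᵐ z ∂pZ, DifferentiableAt ℝ (fun θ => G θ z) θ₀)
    {r : ℝ} (hr : 0 < r) {K : Z → ℝ} (hK : MemLp K 2 pZ)
    (hG_lip : ∀ᵐ z ∂pZ, ∀ θ ∈ Metric.ball θ₀ r, ‖G θ z - G θ₀ z‖ ≤ K z * ‖θ - θ₀‖)
    {α : ℝ} (hα : α ∈ Set.Ioc (0 : ℝ) 1) :
    Integrable (fun y : ℝ × Z × Space D => gradSample α σ G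
        (fun t => score (σ t) (mix α (genLaw pZ (G θ₀)) q)) (fun t => score (σ t) q)
        θ₀ y.1 y.2.1 y.2.2) (τ.prod (pZ.prod (stdGaussian (Space D)))) ∧
    (∀ θ ∈ Metric.ball θ₀ r,
      Integrable (fun t => (mixedKL α (σ t) (genLaw pZ (G θ)) q).toReal) τ) ∧
    HasGradientAt (fun θ => ∫ t, (mixedKL α (σ t) (genLaw pZ (G θ)) q).toReal ∂τ)
      (∫ y : ℝ × Z × Space D, gradSample α σ G
        (fun t => score (σ t) (mix α (genLaw pZ (G θ₀)) q)) (fun t => score (σ t) q)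
        θ₀ y.1 y.2.1 y.2.2 ∂(τ.prod (pZ.prod (stdGaussian (Space D))))) θ₀ := by
  have hgen : ∀ θ, IsProbabilityMeasure (genLaw pZ (G θ)) := fun θ =>
    isProbabilityMeasure_genLaw pZ (hG θ)
  have hmix := isProbabilityMeasure_mix hα (genLaw pZ (G θ₀)) q
  set p := mix α (genLaw pZ (G θ₀)) q with hp_def
  set N := stdGaussian (Space D) with hN
  set μ := τ.prod (pZ.prod N) with hμ
  have hGθ2 : ∀ θ ∈ Metric.ball θ₀ r, MemLp (G θ) 2 pZ := fun θ hθ =>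
    memLp_two_of_norm_sub_le (hG θ) (hG θ₀) hG_sq hK (hG_lip.mono fun z hz => hz θ hθ)
  -- the divergence is integrable over the time for each parameter near `θ₀`
  have hKLint : ∀ θ ∈ Metric.ball θ₀ r,
      Integrable (fun t => (mixedKL α (σ t) (genLaw pZ (G θ)) q).toReal) τ := by
    intro θ hθ
    obtain ⟨C, hC⟩ := exists_mixedKL_le hα (hG θ) (hGθ2 θ hθ) q
    refine Integrable.mono' ((((integrable_const 1).add hσ_int).const_mul C).norm)
      (aemeasurable_mixedKL hσ hσ_pos hα _ _).aestronglyMeasurable ?_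
    filter_upwards [hσ_pos] with t ht
    rw [Real.norm_of_nonneg ENNReal.toReal_nonneg]
    refine ENNReal.toReal_le_of_le_ofReal (norm_nonneg _) ((hC _ ht).trans ?_)
    exact ENNReal.ofReal_le_ofReal (Real.le_norm_self _)
  -- a common radius for the two priors
  obtain ⟨R₁, hR₁, hp₁⟩ := exists_half_le_measureReal_closedBall p
  obtain ⟨R₂, hR₂, hq₂⟩ := exists_half_le_measureReal_closedBall q
  set R := max R₁ R₂ with hR_def
  have hR : 0 ≤ R := hR₁.trans (le_max_left _ _)
  have hpR := hp₁.trans (measureReal_mono (μ := p)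
    (Metric.closedBall_subset_closedBall (le_max_left R₁ R₂)))
  have hqR := hq₂.trans (measureReal_mono (μ := q)
    (Metric.closedBall_subset_closedBall (le_max_right R₁ R₂)))
  -- the linear term of the expansion
  set F : EuclideanSpace ℝ (Fin m) → ℝ × Z × Space D → ℝ := fun θ y =>
    α * (logRatio (σ y.1) p q (G θ y.2.1 + σ y.1 • y.2.2) -
      logRatio (σ y.1) p q (G θ₀ y.2.1 + σ y.1 • y.2.2)) with hF
  set g : ℝ × Z × Space D → EuclideanSpace ℝ (Fin m) := fun y =>
    gradSample α σ G (fun t => score (σ t) p) (fun t => score (σ t) q) θ₀ y.1 y.2.1 y.2.2 with hg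
  set bound : ℝ × Z × Space D → ℝ := fun y =>
    2 * ((σ y.1 ^ 2)⁻¹ * ((‖G θ₀ y.2.1‖ + (|K y.2.1| * r + R)) * |K y.2.1|)) +
      2 * ((σ y.1)⁻¹ * (|K y.2.1| * (‖y.2.2‖ + 2))) with hbound
  have hFm : ∀ θ, Measurable (F θ) := fun θ => by
    have h1 := hG θ
    have h2 := hG θ₀
    rw [hF]; fun_prop
  have hσy : ∀ᵐ y ∂μ, 0 < σ y.1 := Measure.quasiMeasurePreserving_fst.ae hσ_pos
  have hqz : Measure.QuasiMeasurePreserving (fun y : ℝ × Z × Space D => y.2.1) μ pZ :=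
    Measure.quasiMeasurePreserving_fst.comp Measure.quasiMeasurePreserving_snd
  -- the segment from `x_t` at `θ₀` to `x_t` at `θ` stays in a ball on which the linear growth of
  -- the scores bounds the Lipschitz constant
  have hlip : ∀ᵐ y ∂μ, ∀ θ ∈ Metric.ball θ₀ r, ‖F θ y - F θ₀ y‖ ≤ bound y * ‖θ - θ₀‖ := by
    filter_upwards [hσy, hqz.ae hG_lip] with y hy hGy θ hθ
    have hδ : ‖θ - θ₀‖ ≤ r := by
      rw [← dist_eq_norm]; exact (Metric.mem_ball.1 hθ).le
    have hdist : ‖G θ y.2.1 - G θ₀ y.2.1‖ ≤ |K y.2.1| * ‖θ - θ₀‖ :=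
      (hGy θ hθ).trans (by gcongr; exact le_abs_self _)
    set M := ‖G θ₀ y.2.1‖ + |K y.2.1| * r + σ y.1 * ‖y.2.2‖ with hM
    have hnε : ‖σ y.1 • y.2.2‖ = σ y.1 * ‖y.2.2‖ := by
      rw [norm_smul, Real.norm_of_nonneg hy.le]
    have h0 : ‖G θ₀ y.2.1 + σ y.1 • y.2.2‖ ≤ M := by
      refine (norm_add_le _ _).trans ?_
      rw [hnε, hM]
      have : 0 ≤ |K y.2.1| * r := by positivity
      linarith
    have h1 : ‖G θ y.2.1 + σ y.1 • y.2.2‖ ≤ M := by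
      refine (norm_add_le _ _).trans ?_
      rw [hnε, hM]
      have h2 := norm_add_le (G θ₀ y.2.1) (G θ y.2.1 - G θ₀ y.2.1)
      rw [add_sub_cancel] at h2
      have h3 : |K y.2.1| * ‖θ - θ₀‖ ≤ |K y.2.1| * r := by gcongr
      linarith
    have hmain := abs_logRatio_sub_le hy hR hpR hqR h0 h1
    rw [add_sub_add_right_eq_sub] at hmain
    have hF0 : F θ₀ y = 0 := by simp [hF]
    rw [hF0, sub_zero, hF, Real.norm_eq_abs, abs_mul, abs_of_pos hα.1]
    calc α * |logRatio (σ y.1) p q (G θ y.2.1 + σ y.1 • y.2.2) -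
          logRatio (σ y.1) p q (G θ₀ y.2.1 + σ y.1 • y.2.2)|
        ≤ 1 * (2 * (σ y.1 ^ 2)⁻¹ * (M + R + 2 * σ y.1) * (|K y.2.1| * ‖θ - θ₀‖)) := by
          gcongr
          · exact hα.2
          · refine hmain.trans ?_
            gcongr
      _ = bound y * ‖θ - θ₀‖ := by
          rw [hbound, hM]
          simp only
          field_simp
          ring
  have hσ_inv : Integrable (fun t => (σ t)⁻¹) τ := by
    refine Integrable.mono' ((integrable_const 1).add hσ_int)
      hσ.inv.aestronglyMeasurable (ae_of_all _ fun t => ?_)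
    rw [Pi.add_apply, Real.norm_eq_abs]
    have e : (((σ t) ^ 2)⁻¹ : ℝ) = |(σ t)⁻¹| ^ 2 := by rw [sq_abs, inv_pow]
    nlinarith [sq_nonneg (|(σ t)⁻¹| - 1), abs_nonneg (σ t)⁻¹, e]
  have hbi : Integrable bound μ := by
    have hKabs : MemLp (fun z => |K z|) 2 pZ := hK.abs
    have hz : Integrable (fun z => (‖G θ₀ z‖ + (|K z| * r + R)) * |K z|) pZ :=
      (hG_sq.norm.add ((hKabs.mul_const r).add (memLp_const R))).integrable_mul hKabs
    have hε : Integrable (fun ε : Space D => ‖ε‖ + 2) N :=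
      (memLp_two_stdGaussian.integrable (by norm_num)).norm.add (integrable_const 2)
    have hzε : Integrable (fun y : Z × Space D => |K y.1| * (‖y.2‖ + 2)) (pZ.prod N) :=
      (hKabs.integrable (by norm_num)).mul_prod hε
    exact ((hσ_int.mul_prod (hz.comp_fst N)).const_mul 2).add
      ((hσ_inv.mul_prod hzε).const_mul 2)
  have hFint : ∀ θ ∈ Metric.ball θ₀ r, Integrable (F θ) μ := fun θ hθ => by
    refine Integrable.mono' (hbi.mul_const ‖θ - θ₀‖) (hFm θ).aestronglyMeasurable ?_
    filter_upwards [hlip] with y hy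
    have hF0 : F θ₀ y = 0 := by simp [hF]
    simpa [hF0] using hy θ hθ
  have hθ₀ : θ₀ ∈ Metric.ball θ₀ r := Metric.mem_ball_self hr
  have hgm : AEStronglyMeasurable g μ :=
    aestronglyMeasurable_gradSample hσ hG hG_diff α
      (by simp only [Function.uncurry_def]; fun_prop)
      (by simp only [Function.uncurry_def]; fun_prop)
  have hderiv : ∀ᵐ y ∂μ, HasFDerivAt (F · y) (InnerProductSpace.toDual ℝ _ (g y)) θ₀ := by
    filter_upwards [hσy, hqz.ae hG_diff] with y hy hGy
    have h1 : HasFDerivAt (fun θ => G θ y.2.1 + σ y.1 • y.2.2)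
        (fderiv ℝ (fun θ => G θ y.2.1) θ₀) θ₀ := hGy.hasFDerivAt.add_const _
    have h2 := (hasGradientAt_logRatio hy p q (G θ₀ y.2.1 + σ y.1 • y.2.2)).hasFDerivAt.comp θ₀ h1
    have h3 := (h2.sub_const (logRatio (σ y.1) p q (G θ₀ y.2.1 + σ y.1 • y.2.2))).const_mul α
    refine h3.congr_fderiv ?_
    ext u
    simp only [hg, gradSample, map_smul, smul_apply, ContinuousLinearMap.comp_apply,
      InnerProductSpace.toDual_apply_apply, ContinuousLinearMap.adjoint_inner_left]
  obtain ⟨hgi, hH⟩ := hasFDerivAt_integral_of_dominated_loc_of_lip' (μ := μ)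
    (Metric.ball_mem_nhds θ₀ hr) (fun θ _ => (hFm θ).aestronglyMeasurable) (hFint θ₀ hθ₀)
    ((LinearIsometryEquiv.continuous _).comp_aestronglyMeasurable hgm) hlip hbi hderiv
  have hgint : Integrable g μ := by
    refine (integrable_norm_iff hgm).1 ?_
    simpa using hgi.norm
  refine ⟨hgint, hKLint, ?_⟩
  -- the error of the expansion
  set Φ : EuclideanSpace ℝ (Fin m) → ℝ := fun θ =>
    ∫ t, (mixedKL α (σ t) (genLaw pZ (G θ)) q).toReal ∂τ with hΦ
  set S := ∫ t, (σ t ^ 2)⁻¹ ∂τ with hS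
  set V := ∫ z, K z ^ 2 ∂pZ with hV
  have herr : ∀ θ ∈ Metric.ball θ₀ r,
      |Φ θ - Φ θ₀ - ∫ y, F θ y ∂μ| ≤ S * V * ‖θ - θ₀‖ ^ 2 := by
    intro θ hθ
    have hKV : ∫ z, ‖G θ z - G θ₀ z‖ ^ 2 ∂pZ ≤ V * ‖θ - θ₀‖ ^ 2 := by
      rw [hV, ← integral_mul_const]
      refine integral_mono_ae
        (((hGθ2 θ hθ).sub hG_sq).integrable_norm_pow (p := 2) (by norm_num))
        (hK.integrable_sq.mul_const _) (hG_lip.mono fun z hz => ?_)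
      have := pow_le_pow_left₀ (norm_nonneg _) (hz θ hθ) 2
      simpa [mul_pow] using this
    have e : Φ θ - Φ θ₀ - ∫ y, F θ y ∂μ =
        ∫ t, ((mixedKL α (σ t) (genLaw pZ (G θ)) q).toReal -
          (mixedKL α (σ t) (genLaw pZ (G θ₀)) q).toReal - ∫ y, F θ (t, y) ∂(pZ.prod N)) ∂τ := by
      rw [hμ, integral_prod _ (hFint θ hθ), integral_sub
        (f := fun t => (mixedKL α (σ t) (genLaw pZ (G θ)) q).toReal -
          (mixedKL α (σ t) (genLaw pZ (G θ₀)) q).toReal)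
        ((hKLint θ hθ).sub (hKLint θ₀ hθ₀)) (hFint θ hθ).integral_prod_left,
        integral_sub (hKLint θ hθ) (hKLint θ₀ hθ₀)]
    rw [e, ← Real.norm_eq_abs, mul_assoc, hS, ← integral_mul_const]
    refine norm_integral_le_of_norm_le (hσ_int.mul_const _) ?_
    filter_upwards [hσ_pos] with t ht
    refine (abs_mixedKL_sub_sub_le hα ht (hG θ) (hG θ₀) (hGθ2 θ hθ) hG_sq q).trans ?_
    have h1 : (2 * σ t ^ 2)⁻¹ ≤ (σ t ^ 2)⁻¹ :=
      inv_anti₀ (by positivity) (by nlinarith [sq_nonneg (σ t)])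
    exact mul_le_mul h1 hKV (integral_nonneg fun _ => by positivity) (by positivity)
  have hO : (fun θ => Φ θ - Φ θ₀ - ∫ y, F θ y ∂μ) =O[𝓝 θ₀] fun θ => ‖θ - θ₀‖ ^ 2 := by
    refine Asymptotics.IsBigO.of_bound (S * V) ?_
    filter_upwards [Metric.ball_mem_nhds θ₀ hr] with θ hθ
    rw [Real.norm_eq_abs, norm_pow, norm_norm]
    exact herr θ hθ
  have hsum := ((hO.hasFDerivAt (by norm_num)).add hH).add_const (Φ θ₀)
  rw [hasGradientAt_iff_hasFDerivAt]
  have hfun : Φ = fun θ =>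
      ((fun θ => Φ θ - Φ θ₀ - ∫ y, F θ y ∂μ) + fun θ => ∫ y, F θ y ∂μ) θ + Φ θ₀ := by
    ext θ; simp
  rw [hfun]
  refine hsum.congr_fderiv ?_
  rw [zero_add]
  exact (InnerProductSpace.toDual ℝ
    (EuclideanSpace ℝ (Fin m))).toContinuousLinearEquiv.integral_comp_comm g

/-! ### From exact scores to minimizers -/

/-- For square-integrable generators the gradient formula at a single time is the averaged formula
for the time distribution concentrated at that time. -/
lemma hasGradientAt_mixedKL (σ : ℝ → ℝ) {t : ℝ} (ht : 0 < σ t)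
    (q : Measure (Space D)) [IsProbabilityMeasure q] {pZ : Measure Z} [IsProbabilityMeasure pZ]
    {G : EuclideanSpace ℝ (Fin m) → Z → Space D} (hG : ∀ θ, Measurable (G θ))
    {θ₀ : EuclideanSpace ℝ (Fin m)} (hG_sq : MemLp (G θ₀) 2 pZ)
    (hG_diff : ∀ᵐ z ∂pZ, DifferentiableAt ℝ (fun θ => G θ z) θ₀)
    {r : ℝ} (hr : 0 < r) {K : Z → ℝ} (hK : MemLp K 2 pZ)
    (hG_lip : ∀ᵐ z ∂pZ, ∀ θ ∈ Metric.ball θ₀ r, ‖G θ z - G θ₀ z‖ ≤ K z * ‖θ - θ₀‖)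
    {α : ℝ} (hα : α ∈ Set.Ioc (0 : ℝ) 1) :
    Integrable (fun y : Z × Space D => gradSample α σ G
        (fun t => score (σ t) (mix α (genLaw pZ (G θ₀)) q)) (fun t => score (σ t) q)
        θ₀ t y.1 y.2) (pZ.prod (stdGaussian (Space D))) ∧
    HasGradientAt (fun θ => (mixedKL α (σ t) (genLaw pZ (G θ)) q).toReal)
      (∫ y : Z × Space D, gradSample α σ G
        (fun t => score (σ t) (mix α (genLaw pZ (G θ₀)) q)) (fun t => score (σ t) q)
        θ₀ t y.1 y.2 ∂(pZ.prod (stdGaussian (Space D)))) θ₀ := by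
  obtain ⟨h1, -, h2⟩ := hasGradientAt_integral_mixedKL (τ := Measure.dirac t) (σ := fun _ => σ t)
    measurable_const (ae_of_all _ fun _ => ht) (integrable_const _) q hG hG_sq hG_diff hr hK
    hG_lip hα
  have h3 := h1.prod_right_ae
  rw [ae_dirac_eq, Filter.eventually_pure] at h3
  rw [integral_prod _ h1] at h2
  simp only [integral_dirac] at h2
  exact ⟨h3, h2⟩

/-- Along the noised generator, minimizers of the losses agree almost everywhere with the exact
scores: the noised law is absolutely continuous with respect to Lebesgue measure. -/
lemma ae_eq_score_noised {τ : Measure ℝ} [SFinite τ] {σ : ℝ → ℝ} (hσ : Measurable σ)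
    (hσ_pos : ∀ᵐ t ∂τ, 0 < σ t) {pZ : Measure Z} [IsProbabilityMeasure pZ] {X : Z → Space D}
    (hX : Measurable X) {p : Measure (Space D)} [SFinite p] {s : ℝ → Space D → Space D}
    (hs : Measurable (Function.uncurry s))
    (h : ∀ᵐ t ∂τ, ∀ᵐ x ∂(vol D), s t x = score (σ t) p x) :
    ∀ᵐ y ∂(τ.prod (pZ.prod (stdGaussian (Space D)))),
      s y.1 (X y.2.1 + σ y.1 • y.2.2) = score (σ y.1) p (X y.2.1 + σ y.1 • y.2.2) := by
  have := isProbabilityMeasure_genLaw pZ hX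
  have hsm : Measurable fun y : ℝ × Z × Space D => s y.1 (X y.2.1 + σ y.1 • y.2.2) :=
    hs.comp (f := fun y : ℝ × Z × Space D => (y.1, X y.2.1 + σ y.1 • y.2.2)) (by fun_prop)
  rw [Measure.ae_prod_iff_ae_ae (measurableSet_eq_fun hsm (by fun_prop))]
  filter_upwards [h, hσ_pos] with t ht hpos
  refine ae_of_ae_map (f := fun y : Z × Space D => X y.1 + σ t • y.2)
    (p := fun x => s t x = score (σ t) p x) (by fun_prop) ?_
  rw [← noisedLaw_genLaw (σ t) hX, noisedLaw_eq_withDensity hpos]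
  exact (withDensity_absolutelyContinuous _ _).ae_le ht

lemma gradSample_congr {Z : Type*} {α : ℝ} {σ : ℝ → ℝ} {G : EuclideanSpace ℝ (Fin m) → Z → Space D}
    {s₁ s₂ s₁' s₂' : ℝ → Space D → Space D} {θ : EuclideanSpace ℝ (Fin m)} {t : ℝ} {z : Z}
    {ε : Space D} (h₁ : s₁ t (G θ z + σ t • ε) = s₁' t (G θ z + σ t • ε))
    (h₂ : s₂ t (G θ z + σ t • ε) = s₂' t (G θ z + σ t • ε)) :
    gradSample α σ G s₁ s₂ θ t z ε = gradSample α σ G s₁' s₂' θ t z ε := by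
  rw [gradSample, gradSample, h₁, h₂]

end DMD

end

theorem mainTheorem6 {D m : ℕ} {Z : Type*} [MeasurableSpace Z]
    -- time distribution on `[0, T]` and noise schedule
    (T : ℝ) (τ : Measure ℝ) [IsProbabilityMeasure τ] (σ : ℝ → ℝ) (hσ : Measurable σ)
    (hτ : ∀ᵐ t ∂τ, t ∈ Set.Icc 0 T ∧ 0 < σ t)
    -- positive weights of the teacher loss and of the modified student loss
    (w v : ℝ → ℝ) (hw : Measurable w) (hv : Measurable v)
    (hw_pos : ∀ᵐ t ∂τ, 0 < w t) (hv_pos : ∀ᵐ t ∂τ, 0 < v t)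
    -- real data, latent law, generator
    (pReal : Measure (DMD.Space D)) [IsProbabilityMeasure pReal]
    (pZ : Measure Z) [IsProbabilityMeasure pZ]
    (G : EuclideanSpace ℝ (Fin m) → Z → DMD.Space D) (hG : ∀ θ, Measurable (G θ))
    (θ₀ : EuclideanSpace ℝ (Fin m))
    -- regularity of the generator at the parameter `θ₀`
    (hG_sq : MemLp (G θ₀) 2 pZ)
    (hG_diff : ∀ᵐ z ∂pZ, DifferentiableAt ℝ (fun θ => G θ z) θ₀)
    (r : ℝ) (hr : 0 < r) (K : Z → ℝ) (hK : MemLp K 2 pZ)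
    (hG_lip : ∀ᵐ z ∂pZ, ∀ θ ∈ Metric.ball θ₀ r, ‖G θ z - G θ₀ z‖ ≤ K z * ‖θ - θ₀‖)
    (α : ℝ) (hα : α ∈ Set.Ioc (0 : ℝ) 1)
    -- teacher score and modified student score
    (sTeach sStud : ℝ → DMD.Space D → DMD.Space D)
    (hTeach : DMD.IsArgmin (DMD.dsmLoss τ w σ pReal) sTeach)
    (hStud : DMD.IsArgmin (DMD.mixedDsmLoss α τ v σ (DMD.genLaw pZ (G θ₀)) pReal) sStud) :
    -- near `θ₀` the divergence is finite
    (∀ᶠ θ in 𝓝 θ₀, ∀ᵐ t ∂τ, DMD.mixedKL α (σ t) (DMD.genLaw pZ (G θ)) pReal ≠ ∞) ∧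
    -- the gradient formula at almost every time
    (∀ᵐ t ∂τ,
      Integrable (fun y : Z × DMD.Space D => DMD.gradSample α σ G sStud sTeach θ₀ t y.1 y.2)
        (pZ.prod (stdGaussian (DMD.Space D))) ∧
      HasGradientAt (fun θ => (DMD.mixedKL α (σ t) (DMD.genLaw pZ (G θ)) pReal).toReal)
        (∫ y : Z × DMD.Space D, DMD.gradSample α σ G sStud sTeach θ₀ t y.1 y.2
          ∂(pZ.prod (stdGaussian (DMD.Space D)))) θ₀) ∧
    -- the averaged formula, whenever the average over `(t, z, ε)` exists
    (Integrable (fun y : ℝ × Z × DMD.Space D =>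
        DMD.gradSample α σ G sStud sTeach θ₀ y.1 y.2.1 y.2.2)
        (τ.prod (pZ.prod (stdGaussian (DMD.Space D)))) →
      Integrable (fun t => gradient
        (fun θ => (DMD.mixedKL α (σ t) (DMD.genLaw pZ (G θ)) pReal).toReal) θ₀) τ ∧
      ∫ t, gradient
          (fun θ => (DMD.mixedKL α (σ t) (DMD.genLaw pZ (G θ)) pReal).toReal) θ₀ ∂τ =
        ∫ y : ℝ × Z × DMD.Space D, DMD.gradSample α σ G sStud sTeach θ₀ y.1 y.2.1 y.2.2
          ∂(τ.prod (pZ.prod (stdGaussian (DMD.Space D))))) ∧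
    -- if `E_t [σ_t⁻²] < ∞`, that average exists and is the gradient of the averaged divergence
    (Integrable (fun t => (σ t ^ 2)⁻¹) τ →
      Integrable (fun y : ℝ × Z × DMD.Space D =>
        DMD.gradSample α σ G sStud sTeach θ₀ y.1 y.2.1 y.2.2)
        (τ.prod (pZ.prod (stdGaussian (DMD.Space D)))) ∧
      (∀ᶠ θ in 𝓝 θ₀, Integrable
        (fun t => (DMD.mixedKL α (σ t) (DMD.genLaw pZ (G θ)) pReal).toReal) τ) ∧
      HasGradientAt
        (fun θ => ∫ t, (DMD.mixedKL α (σ t) (DMD.genLaw pZ (G θ)) pReal).toReal ∂τ)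
        (∫ y : ℝ × Z × DMD.Space D, DMD.gradSample α σ G sStud sTeach θ₀ y.1 y.2.1 y.2.2
          ∂(τ.prod (pZ.prod (stdGaussian (DMD.Space D))))) θ₀) := by
  have hσ_pos : ∀ᵐ t ∂τ, 0 < σ t := hτ.mono fun t ht => ht.2
  have hgen := DMD.isProbabilityMeasure_genLaw pZ (hG θ₀)
  have hmix := DMD.isProbabilityMeasure_mix hα (DMD.genLaw pZ (G θ₀)) pReal
  have hT := DMD.ae_eq_score_noised (pZ := pZ) (p := pReal) hσ hσ_pos (hG θ₀) hTeach.1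
    (DMD.ae_eq_score_of_isArgmin hw hσ hσ_pos hw_pos hTeach)
  have hS := DMD.ae_eq_score_noised (pZ := pZ)
    (p := DMD.mix α (DMD.genLaw pZ (G θ₀)) pReal) hσ hσ_pos (hG θ₀) hStud.1
    (DMD.ae_eq_score_of_isArgmin hv hσ hσ_pos hv_pos (DMD.isArgmin_dsmLoss_mix hv hσ hStud))
  have hg : (fun y : ℝ × Z × DMD.Space D =>
      DMD.gradSample α σ G sStud sTeach θ₀ y.1 y.2.1 y.2.2) =ᵐ[τ.prod (pZ.prod
        (stdGaussian (DMD.Space D)))] fun y => DMD.gradSample α σ G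
          (fun t => DMD.score (σ t) (DMD.mix α (DMD.genLaw pZ (G θ₀)) pReal))
          (fun t => DMD.score (σ t) pReal) θ₀ y.1 y.2.1 y.2.2 := by
    filter_upwards [hT, hS] with y hy₂ hy₁
    exact DMD.gradSample_congr hy₁ hy₂
  have hgrad : ∀ᵐ t ∂τ,
      Integrable (fun y : Z × DMD.Space D => DMD.gradSample α σ G sStud sTeach θ₀ t y.1 y.2)
        (pZ.prod (stdGaussian (DMD.Space D))) ∧
      HasGradientAt (fun θ => (DMD.mixedKL α (σ t) (DMD.genLaw pZ (G θ)) pReal).toReal)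
        (∫ y : Z × DMD.Space D, DMD.gradSample α σ G sStud sTeach θ₀ t y.1 y.2
          ∂(pZ.prod (stdGaussian (DMD.Space D)))) θ₀ := by
    filter_upwards [hσ_pos, Measure.ae_ae_of_ae_prod hg] with t ht hgt
    obtain ⟨h1, h2⟩ := DMD.hasGradientAt_mixedKL σ ht pReal hG hG_sq hG_diff hr hK hG_lip hα
    rw [integrable_congr hgt, integral_congr_ae hgt]
    exact ⟨h1, h2⟩
  refine ⟨?_, hgrad, fun hint => ?_, fun hσ_int => ?_⟩
  · filter_upwards [Metric.ball_mem_nhds θ₀ hr] with θ hθ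
    filter_upwards [hσ_pos] with t ht
    exact DMD.mixedKL_ne_top hα ht (hG θ) (DMD.memLp_two_of_norm_sub_le (hG θ) (hG θ₀) hG_sq hK
      (hG_lip.mono fun z hz => hz θ hθ)) pReal
  · have hae : (fun t => gradient
        (fun θ => (DMD.mixedKL α (σ t) (DMD.genLaw pZ (G θ)) pReal).toReal) θ₀) =ᵐ[τ]
        fun t => ∫ y : Z × DMD.Space D, DMD.gradSample α σ G sStud sTeach θ₀ t y.1 y.2
          ∂(pZ.prod (stdGaussian (DMD.Space D))) := hgrad.mono fun t ht => ht.2.gradient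
    rw [integrable_congr hae, integral_congr_ae hae, integral_prod _ hint]
    exact ⟨hint.integral_prod_left, rfl⟩
  · obtain ⟨h1, h2, h3⟩ := DMD.hasGradientAt_integral_mixedKL hσ hσ_pos hσ_int pReal hG
      hG_sq hG_diff hr hK hG_lip hα
    rw [integrable_congr hg, integral_congr_ae hg]
    exact ⟨h1, Filter.mem_of_superset (Metric.ball_mem_nhds θ₀ hr) h2, h3⟩
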